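/- Let $K$ be a field, let $1\le m\le n$, and let $X=(x_{ij})$ be an $m\times n$ matrix whose entries are distinct indeterminates, with polynomial ring $K[X]=K[x_{ij}\mid 1\le i\le m,\ 1\le j\le n]$. Let $\mathcal G_m(X)$ be the set of maximal minors of $X$, i.e. of the determinants of the $m\times m$ submatrices of $X$ on columns $j_1<\dots<j_m$, and let $I_m(X)\subset K[X]$ be the ideal generated by $\mathcal G_m(X)$. Let $\sigma$ be a diagonal term order on $K[X]$, i.e. one for which the leading term of the determinant of each square submatrix of $X$ is the product of the indeterminates on the diagonal of that submatrix, and let $in(I_m(X))$ be the initial ideal of $I_m(X)$ with respect to $\sigma$, generated by the leading terms of all elements of $I_m(X)$. Then: 1. $\mathcal G_m(X)$ is a reduced Gröbner basis of $I_m(X)$ with respect to $\sigma$; 2. $in(I_m(X))$ is a squarefree monomial ideal, and it is Cohen–Macaulay, i.e. $K[X]/in(I_m(X))$ is a Cohen–Macaulay ring; 3. the simplicial complex $\Delta_X$ associated to $in(I_m(X))$, that is, the unique simplicial complex on the vertex set $\{(i,j)\mid 1\le i\le m,\ 1\le j\le n\}$ whose Stanley–Reisner ideal $\bigl(\prod_{(i,j)\in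 F}x_{ij} \mid F\notin\Delta_X\bigr)$ equals $in(I_m(X))$, is vertex decomposable. Here a simplicial complex is a collection of subsets (faces) closed under taking subsets, $\dim F=|F|-1$ for a face $F$, the dimension of a complex is the maximum of the dimensions of its faces, and a complex is pure if all its maximal faces have the same dimension. For a vertex $k$ of $\Delta$ (so $\{k\}\in\Delta$), put $\operatorname{lk}_k(\Delta)=\{G\in\Delta\mid k\notin G,\ G\cup\{k\}\in\Delta\}$ and $\Delta-k=\{G\in\Delta\mid k\notin G\}$. A complex $\Delta$ is vertex decomposable if it is a simplex (all subsets of some set of vertices, possibly the empty set of vertices), or it has no faces, or there is a vertex $k$ of $\Delta$ such that $\operatorname{lk}_k(\Delta)$ and $\Delta-k$ are both pure and vertex decomposable and $\dim\Delta=\dim(\Delta-k)=\dim\operatorname{lk}_k(\Delta)+1$. -/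

import Mathlib

noncomputable section

namespace MaxMinors

open MvPolynomial

/-! ### Simplicial complexes

A simplicial complex on a finite vertex set `V`, as a collection of subsets of `V` closed under
taking subsets (the empty face is allowed to be a face), is a `LowerSet (Finset V)`.
The complex with no face at all is `⊥`, and the simplex on `F` is `LowerSet.Iic F`. -/

section Complexes

variable {V : Type*} [DecidableEq V]

/-- A facet: a face that is maximal with respect to inclusion. -/
def IsFacet (Δ : LowerSet (Finset V)) (F : Finset V) : Prop :=
  Maximal (fun G => G ∈ Δ) F

/-- The dimension `|F| - 1` of a face. -/
def faceDim (F : Finset V) : WithBot ℤ := (((F.card : ℤ) - 1 : ℤ) : WithBot ℤ)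

open Classical in
/-- The dimension of a complex: the maximum of the dimensions of its faces
(`⊥` if there is no face, `-1` if the only face is the empty one). -/
def dim [Fintype V] (Δ : LowerSet (Finset V)) : WithBot ℤ :=
  (Finset.univ.filter (fun F => F ∈ Δ)).sup faceDim

/-- A complex is pure if each facet has the dimension of the complex. -/
def IsPure [Fintype V] (Δ : LowerSet (Finset V)) : Prop :=
  ∀ F, IsFacet Δ F → faceDim F = dim Δ

/-- The link of `F` in `Δ`. -/
def link (Δ : LowerSet (Finset V)) (F : Finset V) : LowerSet (Finset V) where
  carrier := {G | G ∈ Δ ∧ F ∪ G ∈ Δ ∧ Disjoint F G}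
  lower' := fun _ _ hle h =>
    ⟨Δ.lower hle h.1, Δ.lower (Finset.union_subset_union_right hle) h.2.1,
      h.2.2.mono_right hle⟩

/-- The deletion `Δ - F`. -/
def deletion (Δ : LowerSet (Finset V)) (F : Finset V) : LowerSet (Finset V) where
  carrier := {G | G ∈ Δ ∧ Disjoint F G}
  lower' := fun _ _ hle h => ⟨Δ.lower hle h.1, h.2.mono_right hle⟩

/-- Vertex decomposability. -/
inductive IsVertexDecomposable [Fintype V] : LowerSet (Finset V) → Prop
  | simplex (F : Finset V) : IsVertexDecomposable (LowerSet.Iic F)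
  | empty : IsVertexDecomposable ⊥
  | step (Δ : LowerSet (Finset V)) (k : V) (hk : {k} ∈ Δ)
      (link_pure : IsPure (link Δ {k})) (deletion_pure : IsPure (deletion Δ {k}))
      (link_vd : IsVertexDecomposable (link Δ {k}))
      (deletion_vd : IsVertexDecomposable (deletion Δ {k}))
      (dim_deletion : dim Δ = dim (deletion Δ {k}))
      (dim_link : dim Δ = dim (link Δ {k}) + 1) :
      IsVertexDecomposable Δ

end Complexes

/-! ### Squarefree monomial ideals -/

section Squarefree

variable {V : Type*} (K : Type*) [Field K]

/-- The squarefree monomial with support `F`. -/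
def sqfreeMonomial (F : Finset V) : MvPolynomial V K := ∏ i ∈ F, X i

/-- The Stanley-Reisner ideal of a complex: generated by the squarefree monomials of the
non-faces. -/
def stanleyReisnerIdeal (Δ : LowerSet (Finset V)) : Ideal (MvPolynomial V K) :=
  Ideal.span {p | ∃ F : Finset V, F ∉ Δ ∧ p = sqfreeMonomial K F}

variable {K}

/-- An ideal generated by squarefree monomials. -/
def IsSquarefreeMonomialIdeal (I : Ideal (MvPolynomial V K)) : Prop :=
  ∃ S : Set (Finset V), I = Ideal.span (sqfreeMonomial K '' S)

end Squarefree

/-! ### Cohen-Macaulay rings -/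

/-- A local ring that possesses a regular sequence in its maximal ideal whose length is the
Krull dimension of the ring. For a Noetherian local ring this says depth = dimension. -/
def IsCohenMacaulayLocal (R : Type*) [CommRing R] [IsLocalRing R] : Prop :=
  ∃ rs : List R, (∀ r ∈ rs, r ∈ IsLocalRing.maximalIdeal R) ∧
    RingTheory.Sequence.IsRegular R rs ∧ (rs.length : WithBot ℕ∞) = ringKrullDim R

/-- A Noetherian ring all of whose localizations at maximal ideals are Cohen-Macaulay. -/
def IsCohenMacaulayRing (R : Type*) [CommRing R] : Prop :=
  IsNoetherianRing R ∧
    ∀ (P : Ideal R) [P.IsMaximal], IsCohenMacaulayLocal (Localization.AtPrime P)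

/-- An ideal is called Cohen-Macaulay if its quotient ring is. -/
def IsCohenMacaulayIdeal {R : Type*} [CommRing R] (I : Ideal R) : Prop :=
  IsCohenMacaulayRing (R ⧸ I)

/-! ### Initial ideals and Gröbner bases -/

section Groebner

variable {V K : Type*} [Field K]

/-- The initial ideal of `I`, generated by the leading terms of all elements of `I`. -/
def initialIdeal (σ : MonomialOrder V) (I : Ideal (MvPolynomial V K)) :
    Ideal (MvPolynomial V K) :=
  Ideal.span (σ.leadingTerm '' (I : Set (MvPolynomial V K)))

/-- `G` is a Gröbner basis of `I`: a finite subset of `I` whose leading terms generate the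
initial ideal of `I`. -/
def IsGroebnerBasis (σ : MonomialOrder V) (G : Set (MvPolynomial V K))
    (I : Ideal (MvPolynomial V K)) : Prop :=
  G.Finite ∧ G ⊆ I ∧ Ideal.span (σ.leadingTerm '' G) = initialIdeal σ I

/-- `G` is a reduced Gröbner basis of `I`: each element is monic, and no monomial that occurs in
an element `g` lies in the ideal generated by the leading terms of the other elements. -/
def IsReducedGroebnerBasis (σ : MonomialOrder V) (G : Set (MvPolynomial V K))
    (I : Ideal (MvPolynomial V K)) : Prop :=
  IsGroebnerBasis σ G I ∧ ∀ g ∈ G, σ.Monic g ∧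
    ∀ d ∈ g.support, monomial d (1 : K) ∉ Ideal.span (σ.leadingTerm '' (G \ {g}))

end Groebner

/-! ### Minors of a generic matrix -/

section Minors

variable (m n : ℕ) (K : Type*) [Field K]

/-- The minor of the generic `m × n` matrix `(x_{ij})` on the rows `r 0 < r 1 < …` and the
columns `c 0 < c 1 < …`. -/
def minor {m n : ℕ} {k : ℕ} (r : Fin k ↪o Fin m) (c : Fin k ↪o Fin n) :
    MvPolynomial (Fin m × Fin n) K :=
  ((Matrix.mvPolynomialX (Fin m) (Fin n) K).submatrix r c).det

/-- The set of minors of size `t` of the generic `m × n` matrix. -/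
def minors (t : ℕ) : Set (MvPolynomial (Fin m × Fin n) K) :=
  {p | ∃ (r : Fin t ↪o Fin m) (c : Fin t ↪o Fin n), p = minor K r c}

/-- The ideal of minors of size `t` of the generic `m × n` matrix. -/
def minorsIdeal (t : ℕ) : Ideal (MvPolynomial (Fin m × Fin n) K) :=
  Ideal.span (minors m n K t)

variable {m n}

/-- A term order is diagonal if the leading term of the determinant of each square submatrix is
the product of the indeterminates on its diagonal. -/
def IsDiagonal (σ : MonomialOrder (Fin m × Fin n)) : Prop :=
  ∀ (k : ℕ) (r : Fin k ↪o Fin m) (c : Fin k ↪o Fin n),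
    σ.leadingTerm (minor K r c) = ∏ i : Fin k, X (r i, c i)

end Minors

end MaxMinors

end

/-! A chain is a set of cells `(0, c 0), …, (m - 1, c (m - 1))` with `c` strictly increasing, i.e.
the support of a diagonal term; let `Δ` be the complex of the sets of cells that contain no chain.

An `f` in the ideal of maximal minors vanishes on all matrices of dependent rows. If no monomial of
`f` is divisible by a diagonal term, then `f = 0`: letting one entry of such a matrix tend to
infinity, the part of `f` of top degree in this entry vanishes on the matrices with one row and one
column fewer whose rows are dependent, and induction applies. With division by the minors it
follows that the minors are a Gröbner basis and that the initial ideal is the Stanley-Reisner ideal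
of `Δ`. The last cell `k` is a shedding vertex of `Δ`: the deletion and the link of `k` are
complexes of the same kind for smaller matrices.

A vertex decomposable complex `Δ` on `V` with facets of `d` elements is Cohen-Macaulay because
`K[V] / I_Δ` is finite and projective over the polynomial ring in the `d` elementary symmetric
polynomials of lowest degree. By the exact sequence
`0 → K[V] / (I_Δ : x_k) → K[V] / I_Δ → K[V] / (I_Δ + (x_k)) → 0`, whose outer terms belong to the
cone over the link and to the deletion, this reduces to the simplex with `d` vertices, i.e. to the
polynomial ring in `d` variables as a module over its symmetric polynomials.
-/

noncomputable section

namespace MaxMinors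

open MvPolynomial

section SimplicialComplexes

variable {V : Type*} {Δ : LowerSet (Finset V)} {F : Finset V} {k : V}

theorem mem_deletion_singleton : F ∈ deletion Δ {k} ↔ F ∈ Δ ∧ k ∉ F :=
  and_congr_right' Finset.disjoint_singleton_left

theorem deletion_eq_self (hk : {k} ∉ Δ) : deletion Δ {k} = Δ := by
  ext F
  refine mem_deletion_singleton.trans (and_iff_left_of_imp fun hF hkF => hk ?_)
  exact Δ.lower (Finset.singleton_subset_iff.2 hkF) hF

theorem IsFacet.deletion (hF : IsFacet Δ F) (hk : k ∉ F) : IsFacet (deletion Δ {k}) F :=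
  ⟨mem_deletion_singleton.2 ⟨hF.1, hk⟩, fun _ hG h => hF.2 hG.1 h⟩

theorem mem_link_singleton [DecidableEq V] : F ∈ link Δ {k} ↔ insert k F ∈ Δ ∧ k ∉ F :=
  ⟨fun h => ⟨h.2.1, Finset.disjoint_singleton_left.1 h.2.2⟩, fun h =>
    ⟨Δ.lower (Finset.subset_insert k F) h.1, h.1, Finset.disjoint_singleton_left.2 h.2⟩⟩

theorem IsFacet.link [DecidableEq V] (hF : IsFacet Δ F) (hk : k ∈ F) :
    IsFacet (link Δ {k}) (F.erase k) := by
  refine ⟨mem_link_singleton.2 ⟨?_, F.notMem_erase k⟩, fun G hG h => ?_⟩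
  · simpa only [Finset.insert_erase hk] using hF.1
  · have hFG : F ⊆ insert k G := Finset.insert_erase hk ▸ Finset.insert_subset_insert k h
    obtain ⟨hG, hkG⟩ := mem_link_singleton.1 hG
    exact Finset.subset_erase.2 ⟨(Finset.subset_insert k G).trans (hF.2 hG hFG), hkG⟩

theorem faceDim_mono {G : Finset V} (h : F ⊆ G) : faceDim F ≤ faceDim G :=
  WithBot.coe_le_coe.2 (sub_le_sub_right (Int.ofNat_le.2 (Finset.card_le_card h)) 1)

theorem faceDim_insert [DecidableEq V] (hk : k ∉ F) : faceDim (insert k F) = faceDim F + 1 := by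
  rw [faceDim, faceDim, Finset.card_insert_of_notMem hk, ← WithBot.coe_one, ← WithBot.coe_add,
    Nat.cast_succ, add_sub_right_comm]

variable [Fintype V]

theorem faceDim_le_dim (hF : F ∈ Δ) : faceDim F ≤ dim Δ := by
  classical exact Finset.le_sup (f := faceDim) (by simpa only [Finset.mem_filter_univ] using hF)

theorem dim_le_iff {b : WithBot ℤ} : dim Δ ≤ b ↔ ∀ F ∈ Δ, faceDim F ≤ b := by
  simp [dim, Finset.sup_le_iff]

theorem dim_bot : dim (⊥ : LowerSet (Finset V)) = ⊥ :=
  le_bot_iff.1 (dim_le_iff.2 fun _ hF => absurd hF LowerSet.notMem_bot)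

theorem dim_Iic (F : Finset V) : dim (LowerSet.Iic F) = faceDim F :=
  le_antisymm (dim_le_iff.2 fun _ hG => faceDim_mono hG)
    (faceDim_le_dim (LowerSet.mem_Iic_iff.2 le_rfl))

theorem exists_faceDim_eq_dim (h : Δ ≠ ⊥) : ∃ F ∈ Δ, faceDim F = dim Δ := by
  classical
  have hne : (Finset.univ.filter (· ∈ Δ)).Nonempty := by
    obtain ⟨F, hF⟩ := (LowerSet.coe_nonempty (s := Δ)).2 h
    exact ⟨F, by simpa using hF⟩
  obtain ⟨F, hF, h⟩ := Finset.exists_mem_eq_sup _ hne faceDim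
  exact ⟨F, by simpa using hF, h.symm⟩

variable [DecidableEq V]

theorem dim_eq_max_deletion_link (Δ : LowerSet (Finset V)) (k : V) :
    dim Δ = max (dim (deletion Δ {k})) (dim (link Δ {k}) + 1) := by
  refine le_antisymm (dim_le_iff.2 fun F hF => ?_)
    (max_le (dim_le_iff.2 fun F hF => faceDim_le_dim hF.1) ?_)
  · by_cases hk : k ∈ F
    · rw [← Finset.insert_erase hk] at hF ⊢
      rw [faceDim_insert (F.notMem_erase k)]
      refine le_max_of_le_right (add_le_add_left (faceDim_le_dim ?_) 1)
      exact mem_link_singleton.2 ⟨hF, F.notMem_erase k⟩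
    · exact le_max_of_le_left (faceDim_le_dim (mem_deletion_singleton.2 ⟨hF, hk⟩))
  · rcases eq_or_ne (link Δ {k}) ⊥ with h | h
    · rw [h, dim_bot, WithBot.bot_add]
      exact bot_le
    · obtain ⟨F, hF, hdim⟩ := exists_faceDim_eq_dim h
      obtain ⟨hF, hkF⟩ := mem_link_singleton.1 hF
      rw [← hdim, ← faceDim_insert hkF]
      exact faceDim_le_dim hF

theorem IsVertexDecomposable.isPure (h : IsVertexDecomposable Δ) : IsPure Δ := by
  induction h with
  | simplex F =>
    intro G hG
    rw [dim_Iic, (hG.1 : G ≤ F).antisymm (hG.2 (LowerSet.mem_Iic_iff.2 le_rfl) hG.1)]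
  | empty => exact fun F hF => absurd hF.1 LowerSet.notMem_bot
  | step Δ k _ link_pure deletion_pure _ _ dim_deletion dim_link =>
    intro F hF
    by_cases hk : k ∈ F
    · rw [dim_link, ← link_pure _ (hF.link hk), ← faceDim_insert (F.notMem_erase k),
        Finset.insert_erase hk]
    · rw [dim_deletion, deletion_pure F (hF.deletion hk)]

theorem dim_eq_dim_deletion
    (hdim : link Δ {k} ≠ ⊥ → dim (deletion Δ {k}) = dim (link Δ {k}) + 1) :
    dim Δ = dim (deletion Δ {k}) := by
  rw [dim_eq_max_deletion_link Δ k, max_eq_left]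
  by_cases h : link Δ {k} = ⊥
  · rw [h, dim_bot, WithBot.bot_add]
    exact bot_le
  · exact (hdim h).ge

theorem IsVertexDecomposable.of_deletion_of_link (hdel : IsVertexDecomposable (deletion Δ {k}))
    (hlink : IsVertexDecomposable (link Δ {k}))
    (hdim : link Δ {k} ≠ ⊥ → dim (deletion Δ {k}) = dim (link Δ {k}) + 1) :
    IsVertexDecomposable Δ := by
  by_cases hk : {k} ∈ Δ
  · have hne : link Δ {k} ≠ ⊥ := LowerSet.coe_nonempty.1 ⟨∅, mem_link_singleton.2 (by simpa)⟩
    have h := dim_eq_dim_deletion hdim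
    exact .step Δ k hk hlink.isPure hdel.isPure hlink hdel h (h.trans (hdim hne))
  · exact deletion_eq_self hk ▸ hdel

end SimplicialComplexes

section StanleyReisner

variable {V K : Type*} [Field K]

theorem sqfreeMonomial_eq_monomial (F : Finset V) :
    sqfreeMonomial K F = monomial (∑ i ∈ F, Finsupp.single i 1) (1 : K) :=
  (monomial_sum_one F _).symm

theorem sum_single_one_apply [DecidableEq V] (F : Finset V) (i : V) :
    (∑ j ∈ F, Finsupp.single j 1 : V →₀ ℕ) i = if i ∈ F then 1 else 0 := by
  simp [Finsupp.finsetSum_apply, Finsupp.single_apply]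

theorem support_sum_single_one (F : Finset V) :
    (∑ i ∈ F, Finsupp.single i 1 : V →₀ ℕ).support = F := by
  classical
  ext i
  simp [sum_single_one_apply]

theorem sum_single_one_le_iff {F : Finset V} {d : V →₀ ℕ} :
    ∑ i ∈ F, Finsupp.single i 1 ≤ d ↔ F ⊆ d.support := by
  classical
  refine ⟨fun h => (support_sum_single_one F).symm.subset.trans (Finsupp.support_mono h),
    fun h i => ?_⟩
  rw [sum_single_one_apply]
  split_ifs with hi
  · exact Nat.one_le_iff_ne_zero.2 (Finsupp.mem_support_iff.1 (h hi))
  · exact Nat.zero_le _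

theorem stanleyReisnerIdeal_eq_span_image (Δ : LowerSet (Finset V)) :
    stanleyReisnerIdeal K Δ = Ideal.span (sqfreeMonomial K '' {F | F ∉ Δ}) := by
  refine congrArg Ideal.span (Set.ext fun p => ?_)
  simp only [Set.mem_ofPred_eq, Set.mem_image, eq_comm]

theorem mem_stanleyReisnerIdeal {Δ : LowerSet (Finset V)} {f : MvPolynomial V K} :
    f ∈ stanleyReisnerIdeal K Δ ↔ ∀ d ∈ f.support, d.support ∉ Δ := by
  have hspan : stanleyReisnerIdeal K Δ = Ideal.span ((fun s => monomial s (1 : K)) ''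
      ((fun F : Finset V => ∑ i ∈ F, Finsupp.single i 1) '' {F | F ∉ Δ})) := by
    rw [stanleyReisnerIdeal_eq_span_image, Set.image_image]
    simp only [sqfreeMonomial_eq_monomial]
  rw [hspan, mem_ideal_span_monomial_image]
  refine forall₂_congr fun d _ => ⟨?_, fun h => ?_⟩
  · rintro ⟨_, ⟨F, hF, rfl⟩, hle⟩ hd
    exact hF (Δ.lower (sum_single_one_le_iff.1 hle) hd)
  · exact ⟨_, ⟨d.support, h, rfl⟩, sum_single_one_le_iff.2 subset_rfl⟩

theorem sqfreeMonomial_mem_stanleyReisnerIdeal {Δ : LowerSet (Finset V)} {F : Finset V} :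
    sqfreeMonomial K F ∈ stanleyReisnerIdeal K Δ ↔ F ∉ Δ := by
  classical
  rw [mem_stanleyReisnerIdeal, sqfreeMonomial_eq_monomial, support_monomial, if_neg one_ne_zero]
  simp [support_sum_single_one]

theorem stanleyReisnerIdeal_injective :
    Function.Injective (stanleyReisnerIdeal (V := V) K) := fun Δ Δ' h => by
  ext F
  have hmem : F ∉ Δ ↔ F ∉ Δ' := by
    rw [← sqfreeMonomial_mem_stanleyReisnerIdeal (K := K), h,
      sqfreeMonomial_mem_stanleyReisnerIdeal]
  exact not_iff_not.1 hmem

theorem isCohenMacaulayIdeal_stanleyReisnerIdeal_bot :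
    IsCohenMacaulayIdeal (stanleyReisnerIdeal K (⊥ : LowerSet (Finset V))) := by
  have eq_top : stanleyReisnerIdeal K (⊥ : LowerSet (Finset V)) = ⊤ :=
    Ideal.eq_top_iff_one _ |>.2 (mem_stanleyReisnerIdeal.2 fun _ _ => LowerSet.notMem_bot)
  rw [eq_top]
  exact ⟨isNoetherian_of_subsingleton _ _, fun P hP => absurd (Subsingleton.elim P ⊤) hP.ne_top⟩

theorem stanleyReisnerIdeal_sup_span_X (Δ : LowerSet (Finset V)) (k : V) :
    stanleyReisnerIdeal K Δ ⊔ Ideal.span {X k} = stanleyReisnerIdeal K (deletion Δ {k}) := by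
  classical
  refine le_antisymm (sup_le (Ideal.span_le.2 ?_) ?_) (Ideal.span_le.2 ?_)
  · rintro _ ⟨F, hF, rfl⟩
    exact sqfreeMonomial_mem_stanleyReisnerIdeal.2 fun h => hF h.1
  · rw [Ideal.span_singleton_le_iff_mem, ← Finset.prod_singleton X k]
    exact sqfreeMonomial_mem_stanleyReisnerIdeal.2 fun h =>
      (mem_deletion_singleton.1 h).2 (Finset.mem_singleton_self k)
  · rintro _ ⟨F, hF, rfl⟩
    by_cases hk : k ∈ F
    · exact Ideal.mem_sup_right (Ideal.mem_span_singleton.2 (Finset.dvd_prod_of_mem X hk))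
    · exact Ideal.mem_sup_left (sqfreeMonomial_mem_stanleyReisnerIdeal.2 fun h =>
        hF (mem_deletion_singleton.2 ⟨h, hk⟩))

theorem ker_killCompl_eq_stanleyReisnerIdeal (G : Finset V) :
    RingHom.ker (killCompl (R := K) (Subtype.val_injective (p := (· ∈ G)))) =
      stanleyReisnerIdeal K (LowerSet.Iic G) := by
  classical
  ext f
  rw [RingHom.mem_ker, mem_stanleyReisnerIdeal]
  refine ⟨fun hf d hd hdG => ?_, fun hf => MvPolynomial.ext _ _ fun s => ?_⟩
  · have hd_range : (d.support : Set V) ⊆ Set.range (Subtype.val : G → V) := by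
      rw [Subtype.range_val]
      exact Finset.coe_subset.2 hdG
    rw [mem_support_iff, ← Finsupp.mapDomain_comapDomain _ Subtype.val_injective d hd_range,
      ← coeff_killCompl Subtype.val_injective, hf, coeff_zero] at hd
    exact hd rfl
  · rw [coeff_killCompl, coeff_zero, ← notMem_support_iff]
    refine fun hs => hf _ hs (LowerSet.mem_Iic_iff.2 fun v hv => ?_)
    obtain ⟨w, -, rfl⟩ := Finset.mem_image.1 (Finsupp.mapDomain_support hv)
    exact w.2

end StanleyReisner

section SymmetricPolynomials

open Polynomial (freeMonic)

variable (R : Type*) {S T : Type*} [CommRing R] [CommRing S] [CommRing T]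

section CoeffHom

variable [Algebra R S] [Algebra R T]

/-- The algebra homomorphism from the polynomial ring in `d` variables that sends the `i`-th
variable to the coefficient of `f` in degree `i`. For monic `f` of degree `d` it is the one that
specializes the generic monic polynomial `Polynomial.freeMonic R d` to `f`. -/
def coeffHom (d : ℕ) (f : Polynomial S) : MvPolynomial (Fin d) R →ₐ[R] S :=
  aeval fun i => f.coeff i

theorem coeffHom_X (d : ℕ) (f : Polynomial S) (i : Fin d) : coeffHom R d f (X i) = f.coeff i :=
  aeval_X _ _

variable {R}

theorem map_freeMonic_coeffHom {d : ℕ} {f : Polynomial S} (hf : f.Monic) (hd : f.natDegree = d) :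
    (freeMonic R d).map (coeffHom R d f).toRingHom = f :=
  congrArg Subtype.val ((mapEquivMonic R S d).apply_symm_apply
    (Polynomial.MonicDegreeEq.mk f hf hd))

theorem comp_coeffHom (g : S →ₐ[R] T) (d : ℕ) (f : Polynomial S) :
    g.comp (coeffHom R d f) = coeffHom R d (f.map g.toRingHom) :=
  algHom_ext fun i => by simp [coeffHom_X, Polynomial.coeff_map]

end CoeffHom

section AdjoinRoot

variable {R}

/-- The cofactor of `T - r` in `f`, where `r` is the root adjoined to the base ring of `f`. -/
def rootCofactor (f : Polynomial R) : Polynomial (AdjoinRoot f) :=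
  f.map (AdjoinRoot.of f) /ₘ (.X - .C (AdjoinRoot.root f))

theorem X_sub_C_root_mul_rootCofactor (f : Polynomial R) :
    (.X - .C (AdjoinRoot.root f)) * rootCofactor f = f.map (AdjoinRoot.of f) :=
  Polynomial.mul_divByMonic_eq_iff_isRoot.2 (AdjoinRoot.isRoot_root f)

theorem monic_rootCofactor {f : Polynomial R} (hf : f.Monic) : (rootCofactor f).Monic :=
  (Polynomial.monic_X_sub_C _).of_mul_monic_left
    (X_sub_C_root_mul_rootCofactor f ▸ hf.map (AdjoinRoot.of f))

theorem natDegree_rootCofactor {f : Polynomial R} (hf : f.Monic) [Nontrivial (AdjoinRoot f)] :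
    (rootCofactor f).natDegree = f.natDegree - 1 := by
  rw [rootCofactor, Polynomial.natDegree_divByMonic _ (Polynomial.monic_X_sub_C _),
    hf.natDegree_map, Polynomial.natDegree_X_sub_C]

variable (R) (d : ℕ)

/-- The homomorphism that specializes the generic monic polynomial of degree `d + 1` to the
product of `T - t` and the generic monic polynomial of degree `d`, for a new variable `t`. -/
def splitRootHom : MvPolynomial (Fin (d + 1)) R →ₐ[R] Polynomial (MvPolynomial (Fin d) R) :=
  coeffHom R (d + 1) ((.X - .C Polynomial.X) * (freeMonic R d).map Polynomial.C)

variable [Nontrivial R]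

theorem map_freeMonic_splitRootHom :
    (freeMonic R (d + 1)).map (splitRootHom R d).toRingHom =
      (.X - .C Polynomial.X) * (freeMonic R d).map Polynomial.C := by
  have monic : ((freeMonic R d).map (Polynomial.C (R := MvPolynomial (Fin d) R))).Monic :=
    (Polynomial.monic_freeMonic R d).map _
  refine map_freeMonic_coeffHom ((Polynomial.monic_X_sub_C _).mul monic) ?_
  rw [(Polynomial.monic_X_sub_C _).natDegree_mul monic, Polynomial.natDegree_X_sub_C,
    (Polynomial.monic_freeMonic R d).natDegree_map, Polynomial.natDegree_freeMonic, add_comm]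

theorem eval₂_splitRootHom_freeMonic :
    (freeMonic R (d + 1)).eval₂ (splitRootHom R d).toRingHom Polynomial.X = 0 := by
  rw [Polynomial.eval₂_eq_eval_map, map_freeMonic_splitRootHom, Polynomial.eval_mul,
    Polynomial.eval_sub, Polynomial.eval_X, Polynomial.eval_C, sub_self, zero_mul]

/-- The extension of `splitRootHom` that sends the adjoined root to `t`. -/
def adjoinRootFreeMonicHom :
    AdjoinRoot (freeMonic R (d + 1)) →ₐ[R] Polynomial (MvPolynomial (Fin d) R) :=
  AdjoinRoot.liftAlgHom _ (splitRootHom R d) .X (eval₂_splitRootHom_freeMonic R d)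

theorem adjoinRootFreeMonicHom_root :
    adjoinRootFreeMonicHom R d (AdjoinRoot.root _) = .X :=
  AdjoinRoot.liftAlgHom_root ..

theorem adjoinRootFreeMonicHom_comp_ofAlgHom :
    (adjoinRootFreeMonicHom R d).comp (AdjoinRoot.ofAlgHom R _) = splitRootHom R d :=
  AlgHom.ext fun _ => AdjoinRoot.liftAlgHom_of _ (splitRootHom R d) .X
    (eval₂_splitRootHom_freeMonic R d) _

theorem map_rootCofactor_adjoinRootFreeMonicHom :
    (rootCofactor (freeMonic R (d + 1))).map (adjoinRootFreeMonicHom R d).toRingHom =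
      (freeMonic R d).map Polynomial.C := by
  refine (Polynomial.monic_X_sub_C (Polynomial.X (R := MvPolynomial (Fin d) R))).isRegular.left ?_
  have h := congrArg (Polynomial.map (adjoinRootFreeMonicHom R d).toRingHom)
    (X_sub_C_root_mul_rootCofactor (freeMonic R (d + 1)))
  rw [Polynomial.map_mul, Polynomial.map_sub, Polynomial.map_X, Polynomial.map_C,
    AlgHom.toRingHom_eq_coe, RingHom.coe_coe, adjoinRootFreeMonicHom_root, Polynomial.map_map] at h
  refine h.trans (Eq.trans ?_ (map_freeMonic_splitRootHom R d))
  rw [← adjoinRootFreeMonicHom_comp_ofAlgHom]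
  rfl

variable {R d}

theorem adjoinRootFreeMonicHom_bijective : Function.Bijective (adjoinRootFreeMonicHom R d) := by
  let f := freeMonic R (d + 1)
  let φ := adjoinRootFreeMonicHom R d
  let ψ := Polynomial.aevalTower (coeffHom R d (rootCofactor f)) (AdjoinRoot.root f)
  have ψ_X : ψ.toRingHom .X = AdjoinRoot.root f := Polynomial.aevalTower_X _ _
  have ψ_C : (ψ.toRingHom).comp Polynomial.C = (coeffHom R d (rootCofactor f)).toRingHom :=
    Polynomial.aevalTower_comp_C _ _
  have monic_f : f.Monic := Polynomial.monic_freeMonic R (d + 1)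
  have nontriv : Nontrivial (AdjoinRoot f) := φ.toRingHom.domain_nontrivial
  have natDegree_cofactor : (rootCofactor f).natDegree = d := by
    rw [natDegree_rootCofactor monic_f, Polynomial.natDegree_freeMonic, Nat.add_sub_cancel]
  have φ_ψ : φ.comp ψ = .id _ _ := by
    refine Polynomial.algHom_ext' (algHom_ext fun i => ?_) ?_
    · simpa [ψ, coeffHom_X, Polynomial.coeff_map, Polynomial.coeff_freeMonic] using
        congrArg (Polynomial.coeff · i) (map_rootCofactor_adjoinRootFreeMonicHom R d)
    · exact (congrArg φ ψ_X).trans (adjoinRootFreeMonicHom_root R d)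
  have ψ_split : ψ.comp (splitRootHom R d) = AdjoinRoot.ofAlgHom R f := by
    rw [splitRootHom, comp_coeffHom, Polynomial.map_mul, Polynomial.map_map, ψ_C,
      map_freeMonic_coeffHom (monic_rootCofactor monic_f) natDegree_cofactor, Polynomial.map_sub,
      Polynomial.map_X, Polynomial.map_C, ψ_X, X_sub_C_root_mul_rootCofactor]
    refine algHom_ext fun i => ?_
    simp [coeffHom_X, Polynomial.coeff_freeMonic, f, Polynomial.coeff_map, i.2]
  have ψ_φ : ψ.comp φ = .id _ _ := by
    refine AdjoinRoot.algHom_ext' ?_ ?_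
    · exact (congrArg ψ.comp (adjoinRootFreeMonicHom_comp_ofAlgHom R d)).trans ψ_split
    · exact (congrArg ψ (adjoinRootFreeMonicHom_root R d)).trans ψ_X
  exact Function.bijective_iff_has_inverse.2 ⟨ψ, AlgHom.congr_fun ψ_φ, AlgHom.congr_fun φ_ψ⟩

theorem finite_flat_splitRootHom :
    (splitRootHom R d).toRingHom.Finite ∧ (splitRootHom R d).toRingHom.Flat := by
  have monic := Polynomial.monic_freeMonic R (d + 1)
  have finite := monic.finite_adjoinRoot
  have free := monic.free_adjoinRoot
  have bijective : Function.Bijective (adjoinRootFreeMonicHom R d).toRingHom :=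
    adjoinRootFreeMonicHom_bijective
  rw [← adjoinRootFreeMonicHom_comp_ofAlgHom]
  exact ⟨(RingHom.Finite.of_surjective _ bijective.2).comp (RingHom.finite_algebraMap.2 finite),
    (RingHom.flat_algebraMap_iff.2 inferInstance).comp (.of_bijective bijective)⟩

end AdjoinRoot

section Roots

variable {R}

theorem finite_flat_mapRingHom {S T : Type*} [CommRing S] [CommRing T] {g : S →+* T}
    (hg : g.Finite ∧ g.Flat) :
    (Polynomial.mapRingHom g).Finite ∧ (Polynomial.mapRingHom g).Flat := by
  let _ := g.toAlgebra
  let _ := Polynomial.algebra S T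
  have finite : Module.Finite S T := hg.1
  have flat : Module.Flat S T := hg.2
  have baseChange := (Algebra.IsPushout.symm
    (inferInstance : Algebra.IsPushout S T (Polynomial S) (Polynomial T))).out
  exact ⟨Module.Finite.equiv baseChange.equiv, Module.Flat.of_linearEquiv baseChange.equiv.symm⟩

/-- The polynomial `∏ (T - x_s)`. -/
def prodXSubX (R σ : Type*) [CommRing R] [Fintype σ] : Polynomial (MvPolynomial σ R) :=
  ∏ s, (.X - .C (X s))

theorem monic_prodXSubX (σ : Type*) [Fintype σ] : (prodXSubX R σ).Monic :=
  Polynomial.monic_prod_X_sub_C _ _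

theorem natDegree_prodXSubX [Nontrivial R] (σ : Type*) [Fintype σ] :
    (prodXSubX R σ).natDegree = Fintype.card σ :=
  Polynomial.natDegree_finsetProd_X_sub_C_eq_card _ _

theorem map_freeMonic_coeffHom_prodXSubX [Nontrivial R] (d : ℕ) :
    (freeMonic R d).map (coeffHom R d (prodXSubX R (Fin d))).toRingHom = prodXSubX R (Fin d) :=
  map_freeMonic_coeffHom (monic_prodXSubX _) ((natDegree_prodXSubX _).trans (Fintype.card_fin d))

theorem map_finSuccEquiv_prodXSubX (d : ℕ) :
    (prodXSubX R (Fin (d + 1))).map (finSuccEquiv R d).toRingEquiv.toRingHom =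
      (.X - .C Polynomial.X) * (prodXSubX R (Fin d)).map Polynomial.C := by
  simp [prodXSubX, Fin.prod_univ_succ, Polynomial.map_prod, finSuccEquiv_X_zero,
    finSuccEquiv_X_succ]

theorem finSuccEquiv_comp_coeffHom_prodXSubX [Nontrivial R] (d : ℕ) :
    (finSuccEquiv R d : _ →ₐ[R] _).comp (coeffHom R (d + 1) (prodXSubX R (Fin (d + 1)))) =
      (Polynomial.mapAlgHom (coeffHom R d (prodXSubX R (Fin d)))).comp (splitRootHom R d) := by
  let h := coeffHom R d (prodXSubX R (Fin d))
  have map_C : (Polynomial.mapAlgHom h).toRingHom.comp Polynomial.C =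
      Polynomial.C.comp h.toRingHom := Polynomial.mapRingHom_comp_C _
  have map_X : (Polynomial.mapAlgHom h).toRingHom Polynomial.X = Polynomial.X :=
    Polynomial.map_X _
  rw [splitRootHom, comp_coeffHom, comp_coeffHom, Polynomial.map_mul, Polynomial.map_map, map_C,
    ← Polynomial.map_map, map_freeMonic_coeffHom_prodXSubX, Polynomial.map_sub, Polynomial.map_X,
    Polynomial.map_C, map_X]
  exact congrArg _ (map_finSuccEquiv_prodXSubX d)

theorem finite_flat_coeffHom_prodXSubX_fin [Nontrivial R] (d : ℕ) :
    (coeffHom R d (prodXSubX R (Fin d))).toRingHom.Finite ∧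
      (coeffHom R d (prodXSubX R (Fin d))).toRingHom.Flat := by
  induction d with
  | zero =>
    rw [show coeffHom R 0 (prodXSubX R (Fin 0)) = .id R _ from algHom_ext (Fin.elim0 ·)]
    exact ⟨.id _, .id _⟩
  | succ d ih =>
    have map := finite_flat_mapRingHom ih
    have split := finite_flat_splitRootHom (R := R) (d := d)
    have bijective := (finSuccEquiv R d).symm.bijective
    rw [← AlgHom.id_comp (coeffHom R (d + 1) _), ← AlgEquiv.symm_comp (finSuccEquiv R d),
      AlgHom.comp_assoc, finSuccEquiv_comp_coeffHom_prodXSubX]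
    exact ⟨(RingHom.Finite.of_surjective _ bijective.2).comp (map.1.comp split.1),
      (split.2.comp map.2).comp (.of_bijective bijective)⟩

theorem finite_flat_coeffHom_prodXSubX [Nontrivial R] {σ : Type*} [Fintype σ] {d : ℕ}
    (hd : Fintype.card σ = d) :
    (coeffHom R d (prodXSubX R σ)).toRingHom.Finite ∧
      (coeffHom R d (prodXSubX R σ)).toRingHom.Flat := by
  let e := renameEquiv R (Fintype.equivFinOfCardEq hd).symm
  have rename : e.toAlgHom.comp (coeffHom R d (prodXSubX R (Fin d))) =
      coeffHom R d (prodXSubX R σ) := by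
    rw [comp_coeffHom]
    congr 1
    simpa [prodXSubX, Polynomial.map_prod, e] using
      (Fintype.equivFinOfCardEq hd).symm.prod_comp fun s =>
        Polynomial.X - Polynomial.C (X (R := R) s)
  have fin := finite_flat_coeffHom_prodXSubX_fin (R := R) d
  rw [← rename]
  exact ⟨(RingHom.Finite.of_surjective _ e.surjective).comp fin.1,
    fin.2.comp (.of_bijective e.bijective)⟩

end Roots

end SymmetricPolynomials

section ProjectiveExtension

variable {A S : Type*} [CommRing A] [CommRing S] [Algebra A S]

theorem finite_projective_of_exact {M₁ M₂ M₃ : Type*} [AddCommGroup M₁] [AddCommGroup M₂]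
    [AddCommGroup M₃] [Module A M₁] [Module A M₂] [Module A M₃] {f : M₁ →ₗ[A] M₂}
    {g : M₂ →ₗ[A] M₃} (h : Function.Exact f g) (hf : Function.Injective f)
    (hg : Function.Surjective g) (h₁ : Module.Finite A M₁ ∧ Module.Projective A M₁)
    (h₃ : Module.Finite A M₃ ∧ Module.Projective A M₃) :
    Module.Finite A M₂ ∧ Module.Projective A M₂ := by
  obtain ⟨finite₁, projective₁⟩ := h₁
  obtain ⟨finite₃, projective₃⟩ := h₃
  obtain ⟨s, hs⟩ := Module.projective_lifting_property g LinearMap.id hg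
  have e := (h.splitSurjectiveEquiv hf ⟨s, hs⟩).1.symm
  exact ⟨.equiv e, .of_equiv e⟩

variable {I J : Ideal S} {x : S}

theorem exact_mulLeft_factor_sup_span (hJ : J ≤ Submodule.comap (LinearMap.mulLeft S x) I) :
    Function.Exact (Submodule.mapQ J I (LinearMap.mulLeft S x) hJ)
      (Ideal.Quotient.factor (le_sup_left : I ≤ I ⊔ Ideal.span {x})) := by
  have mapQ_mk (z : S) : Submodule.mapQ J I (LinearMap.mulLeft S x) hJ (Ideal.Quotient.mk J z) =
      Ideal.Quotient.mk I (x * z) := rfl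
  intro y
  obtain ⟨y, rfl⟩ := Ideal.Quotient.mk_surjective y
  rw [Ideal.Quotient.factor_mk, Ideal.Quotient.eq_zero_iff_mem]
  constructor
  · intro hy
    obtain ⟨a, ha, b, hb, rfl⟩ := Submodule.mem_sup.1 hy
    obtain ⟨c, rfl⟩ := Ideal.mem_span_singleton'.1 hb
    refine ⟨Ideal.Quotient.mk J c, ?_⟩
    rw [mapQ_mk, map_add, Ideal.Quotient.eq_zero_iff_mem.2 ha, zero_add, mul_comm]
  · rintro ⟨z, hz⟩
    obtain ⟨z, rfl⟩ := Ideal.Quotient.mk_surjective z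
    rw [mapQ_mk, Ideal.Quotient.eq] at hz
    rw [← sub_sub_cancel (x * z) y]
    exact sub_mem (Ideal.mul_mem_right _ _ (Ideal.mem_sup_right (Ideal.mem_span_singleton_self x)))
      (Ideal.mem_sup_left hz)

theorem finite_projective_quotient_of_colon (hJ : ∀ y, y ∈ J ↔ x * y ∈ I)
    (h₁ : Module.Finite A (S ⧸ J) ∧ Module.Projective A (S ⧸ J))
    (h₃ : Module.Finite A (S ⧸ (I ⊔ Ideal.span {x})) ∧
      Module.Projective A (S ⧸ (I ⊔ Ideal.span {x}))) :
    Module.Finite A (S ⧸ I) ∧ Module.Projective A (S ⧸ I) := by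
  have hle : J ≤ Submodule.comap (LinearMap.mulLeft S x) I := fun y => (hJ y).1
  let f := (Submodule.mapQ J I (LinearMap.mulLeft S x) hle).restrictScalars A
  let g := (Ideal.Quotient.factorₐ A (le_sup_left : I ≤ I ⊔ Ideal.span {x})).toLinearMap
  have injective_f : Function.Injective f := by
    refine (injective_iff_map_eq_zero f).2 fun z hz => ?_
    obtain ⟨z, rfl⟩ := Ideal.Quotient.mk_surjective z
    exact Ideal.Quotient.eq_zero_iff_mem.2 ((hJ z).2 (Ideal.Quotient.eq_zero_iff_mem.1 hz))
  exact finite_projective_of_exact (f := f) (g := g) (exact_mulLeft_factor_sup_span hle)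
    injective_f (Ideal.Quotient.factor_surjective le_sup_left) h₁ h₃

end ProjectiveExtension

section CohenMacaulay

open RingTheory.Sequence

theorem isWeaklyRegular_map_ringEquiv {R S : Type*} [CommRing R] [CommRing S] (e : R ≃+* S)
    {rs : List R} (h : IsWeaklyRegular R rs) : IsWeaklyRegular S (rs.map e) :=
  (e.toAddEquiv.isWeaklyRegular_congr
    (List.forall₂_map_right_iff.2 (List.forall₂_same.2 fun r _ => map_mul e r))).1 h

theorem isWeaklyRegular_cons_map {C S : Type*} [CommRing C] [CommRing S] [Algebra C S]
    {rs : List C} (h : IsWeaklyRegular C rs) {s : S} (hs : IsSMulRegular S s)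
    [Module.Flat C (QuotSMulTop s S)] : IsWeaklyRegular S (s :: rs.map (algebraMap C S)) := by
  rw [isWeaklyRegular_cons_iff, isWeaklyRegular_map_algebraMap_iff]
  exact ⟨hs, ((TensorProduct.rid C (QuotSMulTop s S)).isWeaklyRegular_congr rs).1
    h.isWeaklyRegular_lTensor⟩

theorem isWeaklyRegular_cons_map_C {C : Type*} [CommRing C] {rs : List C}
    (h : IsWeaklyRegular C rs) {g : Polynomial C} (hg : g.Monic) :
    IsWeaklyRegular (Polynomial C) (g :: rs.map Polynomial.C) := by
  have free : Module.Free C (Polynomial C ⧸ Ideal.span {g}) := hg.free_quotient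
  let e : QuotSMulTop g (Polynomial C) ≃ₗ[Polynomial C] Polynomial C ⧸ Ideal.span {g} :=
    Submodule.quotEquivOfEq _ _ (by
      rw [← Submodule.ideal_span_singleton_smul, smul_eq_mul, Ideal.mul_top])
  have flat : Module.Flat C (QuotSMulTop g (Polynomial C)) :=
    .of_linearEquiv (e.restrictScalars C)
  exact isWeaklyRegular_cons_map h hg.isRegular.left

theorem isWeaklyRegular_ofFn_aeval_X {B : Type*} [CommRing B] {d : ℕ} {g : Fin d → Polynomial B}
    (hg : ∀ i, (g i).Monic) :
    IsWeaklyRegular (MvPolynomial (Fin d) B)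
      (List.ofFn fun i => Polynomial.aeval (X (R := B) i) (g i)) := by
  induction d with
  | zero => exact .nil _ _
  | succ d ih =>
    let e := finSuccEquiv B d
    have e_zero : e.symm ((g 0).map C) = Polynomial.aeval (X 0) (g 0) := by
      rw [e.symm_apply_eq, ← Polynomial.aeval_algHom_apply e, finSuccEquiv_X_zero]
      exact (Polynomial.aeval_X_left_eq_map _).symm
    have e_succ (i : Fin d) : e.symm (Polynomial.C (Polynomial.aeval (X i) (g i.succ))) =
        Polynomial.aeval (X i.succ) (g i.succ) := by
      rw [e.symm_apply_eq, ← Polynomial.aeval_algHom_apply e, finSuccEquiv_X_succ]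
      exact (Polynomial.aeval_algHom_apply Polynomial.CAlgHom _ _).symm
    simpa [List.ofFn_succ, Function.comp_def, e_zero, e_succ] using
      isWeaklyRegular_map_ringEquiv e.symm.toRingEquiv
        (isWeaklyRegular_cons_map_C (ih fun i => hg i.succ) ((hg 0).map C))

theorem exists_isWeaklyRegular_of_isMaximal {K : Type*} [Field K] {d : ℕ}
    (P : Ideal (MvPolynomial (Fin d) K)) [P.IsMaximal] :
    ∃ rs : List (MvPolynomial (Fin d) K), rs.length = d ∧ (∀ r ∈ rs, r ∈ P) ∧
      IsWeaklyRegular (MvPolynomial (Fin d) K) rs := by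
  let _ : Field (MvPolynomial (Fin d) K ⧸ P) := Ideal.Quotient.field P
  have finite : Module.Finite K (MvPolynomial (Fin d) K ⧸ P) :=
    finite_of_finite_type_of_isJacobsonRing K _
  let g (i : Fin d) := minpoly K (Ideal.Quotient.mk P (X i))
  refine ⟨List.ofFn fun i => Polynomial.aeval (X i) (g i), List.length_ofFn, ?_,
    isWeaklyRegular_ofFn_aeval_X fun i => minpoly.monic (Algebra.IsIntegral.isIntegral _)⟩
  intro r hr
  obtain ⟨i, rfl⟩ := List.mem_ofFn.1 hr
  rw [← Ideal.Quotient.eq_zero_iff_mem, ← Ideal.Quotient.mkₐ_eq_mk K,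
    ← Polynomial.aeval_algHom_apply]
  exact minpoly.aeval K _

theorem ringKrullDim_le_of_isIntegral (A R : Type*) [CommRing A] [CommRing R] [Algebra A R]
    [Algebra.IsIntegral A R] : ringKrullDim R ≤ ringKrullDim A :=
  Order.krullDim_le_of_strictMono (PrimeSpectrum.comap (algebraMap A R)) fun _ _ h =>
    Ideal.IsIntegral.comap_lt_comap h

theorem isCohenMacaulayLocal_localization {R : Type*} [CommRing R] [IsNoetherianRing R]
    (P : Ideal R) [P.IsMaximal] {rs : List R} (regular : IsWeaklyRegular R rs)
    (hrs : ∀ r ∈ rs, r ∈ P) (hdim : ringKrullDim R ≤ rs.length) :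
    IsCohenMacaulayLocal (Localization.AtPrime P) := by
  let L := Localization.AtPrime P
  have regular_L := regular.isRegular_of_isLocalization_of_mem L P hrs
  refine ⟨rs.map (algebraMap R L), fun r hr => ?_, regular_L, le_antisymm ?_ ?_⟩
  · obtain ⟨q, hq, rfl⟩ := List.mem_map.1 hr
    exact (IsLocalization.AtPrime.to_map_mem_maximal_iff _ P _).2 (hrs q hq)
  · have nontrivial : Nontrivial (L ⧸ Ideal.ofList (rs.map (algebraMap R L))) := by
      refine Ideal.Quotient.nontrivial_iff.2 fun h => regular_L.top_ne_smul ?_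
      rw [h, smul_eq_mul, Ideal.mul_top]
    rw [← ringKrullDim_add_length_eq_ringKrullDim_of_isRegular _ regular_L]
    exact le_add_of_nonneg_left ringKrullDim_nonneg_of_nontrivial
  · rw [IsLocalization.AtPrime.ringKrullDim_eq_height P, List.length_map]
    exact (Ideal.height_le_ringKrullDim_of_ne_top (Ideal.IsPrime.ne_top inferInstance)).trans hdim

theorem isCohenMacaulayRing_of_finite_of_flat (K R : Type*) (d : ℕ) [Field K] [CommRing R]
    [Algebra (MvPolynomial (Fin d) K) R] [Module.Finite (MvPolynomial (Fin d) K) R]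
    [Module.Flat (MvPolynomial (Fin d) K) R] : IsCohenMacaulayRing R := by
  have noetherian : IsNoetherianRing R := .of_finite (MvPolynomial (Fin d) K) R
  refine ⟨noetherian, fun P _ => ?_⟩
  let p := P.comap (algebraMap (MvPolynomial (Fin d) K) R)
  have maximal_p : p.IsMaximal := Ideal.isMaximal_comap_of_isIntegral_of_isMaximal P
  obtain ⟨rs, length_rs, hrs, regular⟩ := exists_isWeaklyRegular_of_isMaximal p
  refine isCohenMacaulayLocal_localization P (regular.of_flat (S := R)) ?_ ?_
  · exact List.forall_mem_map.2 hrs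
  · refine (ringKrullDim_le_of_isIntegral (MvPolynomial (Fin d) K) R).trans_eq ?_
    rw [MvPolynomial.ringKrullDim_of_isNoetherianRing, ringKrullDim_eq_zero_of_field, zero_add,
      List.length_map, length_rs, Nat.card_fin]

end CohenMacaulay

section VertexDecomposable

variable {V : Type*} [DecidableEq V]

/-- The iterated cone over `Δ` with the vertices in `C` as apices, for `C` disjoint from the faces
of `Δ`. -/
def cone (Δ : LowerSet (Finset V)) (C : Finset V) : LowerSet (Finset V) where
  carrier := {F | F \ C ∈ Δ}
  lower' := fun _ _ hle h => Δ.lower (Finset.sdiff_subset_sdiff hle le_rfl) h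

variable {Δ : LowerSet (Finset V)} {C F : Finset V} {k : V}

theorem mem_cone : F ∈ cone Δ C ↔ F \ C ∈ Δ :=
  Iff.rfl

theorem cone_empty (Δ : LowerSet (Finset V)) : cone Δ ∅ = Δ :=
  LowerSet.ext (Set.ext fun F => by rw [SetLike.mem_coe, mem_cone, F.sdiff_empty, SetLike.mem_coe])

theorem cone_Iic (F C : Finset V) : cone (LowerSet.Iic F) C = LowerSet.Iic (F ∪ C) :=
  LowerSet.ext (Set.ext fun G => sdiff_le_iff' (a := G))

theorem deletion_cone (hk : k ∉ C) : deletion (cone Δ C) {k} = cone (deletion Δ {k}) C := by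
  refine LowerSet.ext (Set.ext fun F => ?_)
  simp only [SetLike.mem_coe, mem_deletion_singleton, mem_cone, Finset.mem_sdiff, hk,
    not_false_eq_true, and_true]

theorem mem_cone_link_insert (hk : k ∉ C) :
    F ∈ cone (link Δ {k}) (insert k C) ↔ insert k F ∈ cone Δ C := by
  have insert_sdiff_insert : insert k (F \ insert k C) = insert k F \ C := by grind
  rw [mem_cone, mem_cone, mem_link_singleton, insert_sdiff_insert, and_iff_left (by simp)]

variable {K : Type*} [Field K]

theorem mem_stanleyReisnerIdeal_iff_X_mul_mem {Δ' : LowerSet (Finset V)}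
    (h : ∀ F, F ∈ Δ' ↔ insert k F ∈ Δ) (f : MvPolynomial V K) :
    f ∈ stanleyReisnerIdeal K Δ' ↔ X k * f ∈ stanleyReisnerIdeal K Δ := by
  have support_insert (d : V →₀ ℕ) :
      (addLeftEmbedding (Finsupp.single k 1) d).support = insert k d.support := by
    ext v
    by_cases hv : v = k <;> simp [hv]
  simp only [mem_stanleyReisnerIdeal, support_X_mul, Finset.mem_map, forall_exists_index, and_imp,
    forall_apply_eq_imp_iff₂, support_insert, h]

variable [Fintype V]

theorem IsVertexDecomposable.finite_projective_cone {A : Type*} [CommRing A]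
    [Algebra A (MvPolynomial V K)] {d : ℕ}
    (simplex : ∀ G : Finset V, G.card = d →
      Module.Finite A (MvPolynomial V K ⧸ stanleyReisnerIdeal K (LowerSet.Iic G)) ∧
      Module.Projective A (MvPolynomial V K ⧸ stanleyReisnerIdeal K (LowerSet.Iic G)))
    (hΔ : IsVertexDecomposable Δ) (hC : ∀ F ∈ Δ, Disjoint F C) (hdim : dim Δ + 1 + C.card = d) :
    Module.Finite A (MvPolynomial V K ⧸ stanleyReisnerIdeal K (cone Δ C)) ∧
      Module.Projective A (MvPolynomial V K ⧸ stanleyReisnerIdeal K (cone Δ C)) := by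
  induction hΔ generalizing C with
  | simplex F =>
    rw [cone_Iic]
    refine simplex _ ?_
    rw [Finset.card_union_of_disjoint (hC F (LowerSet.mem_Iic_iff.2 le_rfl))]
    rw [dim_Iic, faceDim] at hdim
    have card_eq : (F.card : ℤ) - 1 + 1 + C.card = d := WithBot.coe_injective hdim
    omega
  | empty => simp [dim_bot] at hdim
  | step Δ k hk _ _ _ _ dim_deletion dim_link link_ih deletion_ih =>
    have hkC : k ∉ C := Finset.disjoint_singleton_left.1 (hC _ hk)
    refine finite_projective_quotient_of_colon
      (mem_stanleyReisnerIdeal_iff_X_mul_mem fun F => mem_cone_link_insert hkC)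
      (link_ih (fun F hF => ?_) ?_) ?_
    · obtain ⟨hF, hkF⟩ := mem_link_singleton.1 hF
      exact Finset.disjoint_insert_right.2
        ⟨hkF, Finset.disjoint_of_subset_left (Finset.subset_insert k F) (hC _ hF)⟩
    · rw [Finset.card_insert_of_notMem hkC, ← hdim, dim_link]
      push_cast
      ac_rfl
    · rw [stanleyReisnerIdeal_sup_span_X, deletion_cone hkC]
      exact deletion_ih (fun F hF => hC F hF.1) (dim_deletion ▸ hdim)

end VertexDecomposable

section Parameters

variable {R V : Type*} [CommRing R] [Fintype V]

theorem map_killCompl_prodXSubX (G : Finset V) :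
    (prodXSubX R V).map (killCompl (Subtype.val_injective (p := (· ∈ G)))).toRingHom =
      .X ^ (Fintype.card V - G.card) * prodXSubX R G := by
  classical
  have killCompl_of_mem (v : G) :
      killCompl (Subtype.val_injective (p := (· ∈ G))) (X (R := R) (v : V)) = X v := by
    rw [← rename_X Subtype.val v, killCompl_rename_app]
  have killCompl_of_notMem {v : V} (hv : v ∈ Gᶜ) :
      killCompl (Subtype.val_injective (p := (· ∈ G))) (X (R := R) v) = 0 := by
    simp [killCompl, Finset.mem_compl.1 hv]
  simp only [prodXSubX, Polynomial.map_prod, Polynomial.map_sub, Polynomial.map_X,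
    Polynomial.map_C, AlgHom.toRingHom_eq_coe, RingHom.coe_coe]
  rw [← Finset.prod_compl_mul_prod G, ← Finset.card_compl, ← Finset.prod_const]
  refine congrArg₂ _ (Finset.prod_congr rfl fun v hv => ?_) ?_
  · rw [killCompl_of_notMem hv, Polynomial.C_0, sub_zero]
  · rw [← Finset.prod_coe_sort]
    simp only [killCompl_of_mem]

variable (R V)

/-- The homomorphism that sends the `d` variables to the coefficients of `∏ (T - x_v)` of
codegree `1, …, d`, i.e. up to sign to the elementary symmetric polynomials of these degrees. -/
def symmetricParameterHom (d : ℕ) : MvPolynomial (Fin d) R →ₐ[R] MvPolynomial V R :=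
  aeval fun i => (prodXSubX R V).coeff (i + (Fintype.card V - d))

variable {R V}

theorem killCompl_comp_symmetricParameterHom {G : Finset V} {d : ℕ} (hG : G.card = d) :
    (killCompl (Subtype.val_injective (p := (· ∈ G)))).comp (symmetricParameterHom R V d) =
      coeffHom R d (prodXSubX R G) := by
  refine algHom_ext fun i => ?_
  have map_coeff := congrArg (Polynomial.coeff · (i + (Fintype.card V - d)))
    (map_killCompl_prodXSubX (R := R) G)
  rw [hG] at map_coeff
  simpa [symmetricParameterHom, coeffHom_X, Polynomial.coeff_map,
    Polynomial.coeff_X_pow_mul] using map_coeff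

variable {K : Type*} [Field K]

theorem finite_flat_mk_comp_symmetricParameterHom {G : Finset V} {d : ℕ} (hG : G.card = d) :
    ((Ideal.Quotient.mk (stanleyReisnerIdeal K (LowerSet.Iic G))).comp
        (symmetricParameterHom K V d).toRingHom).Finite ∧
      ((Ideal.Quotient.mk (stanleyReisnerIdeal K (LowerSet.Iic G))).comp
        (symmetricParameterHom K V d).toRingHom).Flat := by
  let restrict := killCompl (R := K) (Subtype.val_injective (p := (· ∈ G)))
  have surjective : Function.Surjective restrict :=
    fun p => ⟨rename Subtype.val p, killCompl_rename_app _ p⟩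
  let e := RingHom.quotientKerEquivOfSurjective (f := restrict.toRingHom) surjective
  have factor : (Ideal.Quotient.mk (RingHom.ker restrict)).comp
      (symmetricParameterHom K V d).toRingHom =
        e.symm.toRingHom.comp (coeffHom K d (prodXSubX K G)).toRingHom := by
    rw [← killCompl_comp_symmetricParameterHom hG]
    exact RingHom.ext fun p => e.eq_symm_apply.2 rfl
  obtain ⟨finite, flat⟩ :=
    finite_flat_coeffHom_prodXSubX (R := K) (Fintype.card_coe G |>.trans hG)
  rw [← ker_killCompl_eq_stanleyReisnerIdeal, factor]
  exact ⟨(RingHom.Finite.of_surjective _ e.symm.surjective).comp finite,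
    flat.comp (.of_bijective e.symm.bijective)⟩

theorem IsVertexDecomposable.isCohenMacaulayIdeal [DecidableEq V] {Δ : LowerSet (Finset V)}
    (hΔ : IsVertexDecomposable Δ) : IsCohenMacaulayIdeal (stanleyReisnerIdeal K Δ) := by
  rcases eq_or_ne Δ ⊥ with rfl | hne
  · exact isCohenMacaulayIdeal_stanleyReisnerIdeal_bot
  obtain ⟨F, -, dim_eq⟩ := exists_faceDim_eq_dim hne
  have dim_add_one : dim Δ + 1 = (F.card : WithBot ℤ) := by
    rw [← dim_eq, faceDim]
    exact congrArg WithBot.some (sub_add_cancel (F.card : ℤ) 1)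
  let A := MvPolynomial (Fin F.card) K
  let quotient (Δ : LowerSet (Finset V)) := MvPolynomial V K ⧸ stanleyReisnerIdeal K Δ
  let _ : Algebra A (MvPolynomial V K) := (symmetricParameterHom K V F.card).toRingHom.toAlgebra
  have simplex (G : Finset V) (hG : G.card = F.card) :
      Module.Finite A (quotient (LowerSet.Iic G)) ∧
        Module.Projective A (quotient (LowerSet.Iic G)) := by
    obtain ⟨finite, flat⟩ := finite_flat_mk_comp_symmetricParameterHom (K := K) hG
    change Module.Finite A (quotient (LowerSet.Iic G)) at finite
    change Module.Flat A (quotient (LowerSet.Iic G)) at flat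
    have finitePresentation := Module.finitePresentation_of_finite A (quotient (LowerSet.Iic G))
    exact ⟨finite, Module.Flat.projective_of_finitePresentation⟩
  obtain ⟨finite, projective⟩ := hΔ.finite_projective_cone (C := ∅) simplex
    (fun _ _ => Finset.disjoint_empty_right _) (by simpa using dim_add_one)
  rw [cone_empty] at finite projective
  exact isCohenMacaulayRing_of_finite_of_flat K _ F.card

end Parameters

section Chains

variable {M N : ℕ} {W F : Finset (Fin M × Fin N)} {m n : ℕ}

/-- `F` contains cells `(0, c 0), …, (m - 1, c (m - 1))` with `c 0 < … < c (m - 1) < n`. These are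
the supports of the diagonal terms of the maximal minors of the first `m` rows and `n` columns. -/
def HasChain (F : Finset (Fin M × Fin N)) (m n : ℕ) : Prop :=
  ∃ c : ℕ → ℕ, StrictMonoOn c (Set.Iio m) ∧
    ∀ i < m, c i < n ∧ ∃ v ∈ F, v.1.val = i ∧ v.2.val = c i

theorem hasChain_zero (F : Finset (Fin M × Fin N)) (n : ℕ) : HasChain F 0 n :=
  ⟨id, strictMono_id.strictMonoOn _, by simp⟩

theorem HasChain.le (h : HasChain F m n) : m ≤ n := by
  obtain ⟨c, hc, h⟩ := h
  simpa using Finset.card_le_card_of_injOn (s := Finset.range m) (t := Finset.range n) c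
    (fun i hi => by simpa using (h i (by simpa using hi)).1) (by simpa using hc.injOn)

theorem HasChain.mono {G : Finset (Fin M × Fin N)} (hFG : F ⊆ G) (h : HasChain F m n) :
    HasChain G m n := by
  obtain ⟨c, hc, h⟩ := h
  exact ⟨c, hc, fun i hi => ⟨(h i hi).1, (h i hi).2.imp fun v hv => ⟨hFG hv.1, hv.2⟩⟩⟩

theorem HasChain.pred (h : HasChain F (m + 1) (n + 1)) : HasChain F m n := by
  obtain ⟨c, hc, h⟩ := h
  refine ⟨c, hc.mono (Set.Iio_subset_Iio m.le_succ), fun i hi => ?_⟩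
  have hlt : c i < c m := hc (Set.mem_Iio.2 (hi.trans m.lt_succ_self)) m.lt_succ_self hi
  have hlt_succ := (h m m.lt_succ_self).1
  exact ⟨by lia, (h i (hi.trans m.lt_succ_self)).2⟩

theorem hasChain_insert_iff {i : Fin M} {j : Fin N} :
    HasChain (insert (i, j) F) m j ↔ HasChain F m j := by
  refine ⟨?_, HasChain.mono (Finset.subset_insert _ _)⟩
  rintro ⟨c, hc, h⟩
  refine ⟨c, hc, fun i' hi' => ⟨(h i' hi').1, ?_⟩⟩
  obtain ⟨hlt, v, hv, hv1, hv2⟩ := h i' hi'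
  refine ⟨v, Finset.mem_of_mem_insert_of_ne hv ?_, hv1, hv2⟩
  rintro rfl
  exact hlt.ne' hv2

theorem HasChain.snoc {i : Fin M} {j : Fin N} (hij : (i, j) ∈ F) (h : HasChain F i j) :
    HasChain F (i + 1) (j + 1) := by
  obtain ⟨c, hc, h⟩ := h
  refine ⟨Function.update c i j, fun a ha b hb hab => ?_, fun a ha => ?_⟩
  · simp only [Set.mem_Iio, Nat.lt_succ_iff] at ha hb
    have ha' : a < i := hab.trans_le hb
    rw [Function.update_of_ne ha'.ne]
    rcases hb.eq_or_lt with rfl | hb'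
    · simpa using (h a hab).1
    · simpa [hb'.ne] using hc ha' hb' hab
  · rcases (Nat.lt_succ_iff.1 ha).eq_or_lt with rfl | ha'
    · simpa using ⟨i, j, hij, rfl, rfl⟩
    · simpa only [Function.update_of_ne ha'.ne] using
        ⟨(h a ha').1.trans j.val.lt_succ_self, (h a ha').2⟩

theorem hasChain_succ_iff {i : Fin M} {j : Fin N} :
    HasChain F (i + 1) (j + 1) ↔ HasChain F (i + 1) j ∨ ((i, j) ∈ F ∧ HasChain F i j) := by
  refine ⟨fun hF => ?_, ?_⟩
  · obtain ⟨c, hc, h⟩ := id hF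
    obtain ⟨hlt, ⟨i', j'⟩, hv, hi', hj'⟩ := h i i.val.lt_succ_self
    rcases (Nat.lt_succ_iff.1 hlt).eq_or_lt with hj | hlt
    · obtain rfl := Fin.ext hi'
      obtain rfl := Fin.ext (hj'.trans hj)
      exact .inr ⟨hv, hF.pred⟩
    · refine .inl ⟨c, hc, fun k hk => ⟨lt_of_le_of_lt ?_ hlt, (h k hk).2⟩⟩
      exact hc.monotoneOn hk i.val.lt_succ_self (Nat.lt_succ_iff.1 hk)
  · rintro (⟨c, hc, h⟩ | ⟨hij, h⟩)
    · exact ⟨c, hc, fun k hk => ⟨(h k hk).1.trans j.val.lt_succ_self, (h k hk).2⟩⟩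
    · exact h.snoc hij

theorem hasChain_iff_exists_orderEmbedding {F : Finset (Fin m × Fin n)} :
    HasChain F m n ↔ ∃ c : Fin m ↪o Fin n, ∀ i, (i, c i) ∈ F := by
  constructor
  · rintro ⟨c, hc, h⟩
    refine ⟨OrderEmbedding.ofStrictMono (fun i => ⟨c i, (h i i.2).1⟩)
      fun i j hij => hc i.2 j.2 hij, fun i => ?_⟩
    obtain ⟨⟨i', j'⟩, hv, hi', hj'⟩ := (h i i.2).2
    obtain rfl := Fin.ext hi'
    convert hv
    exact Fin.ext hj'.symm
  · rintro ⟨c, hc⟩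
    refine ⟨fun i => if h : i < m then c ⟨i, h⟩ else 0, fun i hi j hj hij => ?_, fun i hi => ?_⟩
    · simpa only [dif_pos hi.out, dif_pos hj.out] using Fin.lt_def.1 (c.strictMono hij)
    · simp only [dif_pos hi]
      exact ⟨(c ⟨i, hi⟩).2, _, hc ⟨i, hi⟩, rfl, rfl⟩

/-- The complex of the subsets of `W` that contain no chain in the upper left `m × n` block. For
`W` the set of all cells it is the complex of the initial ideal of the ideal of maximal minors;
smaller `W` arise from its links and deletions. -/
def chainComplex (W : Finset (Fin M × Fin N)) (m n : ℕ) :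
    LowerSet (Finset (Fin M × Fin N)) where
  carrier := {F | F ⊆ W ∧ ¬ HasChain F m n}
  lower' := fun _ _ hle h => ⟨hle.trans h.1, fun hc => h.2 (hc.mono hle)⟩

theorem mem_chainComplex : F ∈ chainComplex W m n ↔ F ⊆ W ∧ ¬ HasChain F m n := Iff.rfl

theorem chainComplex_zero (W : Finset (Fin M × Fin N)) (n : ℕ) : chainComplex W 0 n = ⊥ := by
  ext F
  simp [chainComplex, hasChain_zero]

theorem chainComplex_of_lt (W : Finset (Fin M × Fin N)) (h : n < m) :
    chainComplex W m n = LowerSet.Iic W := by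
  ext F
  exact and_iff_left fun hF : HasChain F m n => hF.le.not_gt h

theorem deletion_chainComplex (W : Finset (Fin M × Fin N)) (i : Fin M) (j : Fin N) :
    deletion (chainComplex W (i + 1) (j + 1)) {(i, j)} =
      chainComplex (W.erase (i, j)) (i + 1) j := by
  ext F
  refine mem_deletion_singleton.trans (Iff.trans ?_ mem_chainComplex.symm)
  rw [mem_chainComplex, Finset.subset_erase, hasChain_succ_iff]
  tauto

theorem link_chainComplex {i : Fin M} {j : Fin N} (hk : (i, j) ∈ W) :
    link (chainComplex W (i + 1) (j + 1)) {(i, j)} = chainComplex (W.erase (i, j)) i j := by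
  ext F
  have hchain : HasChain (insert (i, j) F) (i + 1) (j + 1) ↔ HasChain F i j :=
    ⟨fun h => hasChain_insert_iff.1 h.pred,
      fun h => (hasChain_insert_iff.2 h).snoc (Finset.mem_insert_self _ _)⟩
  refine mem_link_singleton.trans (Iff.trans ?_ mem_chainComplex.symm)
  rw [mem_chainComplex, Finset.subset_erase, Finset.insert_subset_iff, hchain]
  tauto

theorem isVertexDecomposable_and_dim_chainComplex_of_erase {i : Fin M} {j : Fin N}
    (hk : (i, j) ∈ W) (hdel : IsVertexDecomposable (chainComplex (W.erase (i, j)) (i + 1) j))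
    (hlink : IsVertexDecomposable (chainComplex (W.erase (i, j)) i j))
    (hdim : chainComplex (W.erase (i, j)) i j ≠ ⊥ →
      dim (chainComplex (W.erase (i, j)) (i + 1) j) =
        dim (chainComplex (W.erase (i, j)) i j) + 1) :
    IsVertexDecomposable (chainComplex W (i + 1) (j + 1)) ∧
      dim (chainComplex W (i + 1) (j + 1)) = dim (chainComplex (W.erase (i, j)) (i + 1) j) := by
  rw [← deletion_chainComplex W i j] at hdel hdim ⊢
  rw [← link_chainComplex hk] at hlink hdim
  exact ⟨.of_deletion_of_link hdel hlink hdim, dim_eq_dim_deletion hdim⟩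

theorem isVertexDecomposable_and_dim_chainComplex (hm : m < M) (hn : n ≤ N) (hmn : m ≤ n)
    (hW : ∀ v : Fin M × Fin N, v.1.val ≤ m → v.2.val < n → v ∈ W) :
    IsVertexDecomposable (chainComplex W (m + 1) n) ∧
      dim (chainComplex W (m + 1) n) = ((W.card + m - n - 1 : ℤ) : WithBot ℤ) := by
  induction n generalizing m W with
  | zero =>
    obtain rfl : m = 0 := by lia
    rw [chainComplex_of_lt W Nat.one_pos, dim_Iic, faceDim]
    simpa using IsVertexDecomposable.simplex W
  | succ n ih =>
    rcases hmn.eq_or_lt with rfl | hlt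
    · rw [chainComplex_of_lt W (Nat.lt_succ_self _), dim_Iic, faceDim]
      simpa using IsVertexDecomposable.simplex W
    let k : Fin M × Fin N := (⟨m, hm⟩, ⟨n, hn⟩)
    have hk : k ∈ W := hW k le_rfl n.lt_succ_self
    have hcard : ((W.erase k).card : ℤ) + 1 = W.card := by
      exact_mod_cast Finset.card_erase_add_one hk
    have hW_erase : ∀ v : Fin M × Fin N, v.1.val ≤ m → v.2.val < n → v ∈ W.erase k :=
      fun v h1 h2 => Finset.mem_erase.2
        ⟨ne_of_apply_ne (fun v => v.2.val) h2.ne, hW v h1 (h2.trans n.lt_succ_self)⟩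
    obtain ⟨del_vd, dim_del⟩ := ih hm (by lia) (by lia) hW_erase
    obtain ⟨link_vd, dim_link⟩ : IsVertexDecomposable (chainComplex (W.erase k) m n) ∧
        (chainComplex (W.erase k) m n ≠ ⊥ → dim (chainComplex (W.erase k) (m + 1) n) =
          dim (chainComplex (W.erase k) m n) + 1) := by
      cases m with
      | zero =>
        have link_eq_bot := chainComplex_zero (W.erase k) n
        exact ⟨link_eq_bot ▸ .empty, fun h => absurd link_eq_bot h⟩
      | succ m =>
        obtain ⟨link_vd, dim_link⟩ :=
          ih (m := m) (by lia) (by lia) (by lia) fun v h => hW_erase v (by lia)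
        refine ⟨link_vd, fun _ => ?_⟩
        rw [dim_del, dim_link, ← WithBot.coe_one, ← WithBot.coe_add, WithBot.coe_inj]
        push_cast
        ring
    obtain ⟨vd, dim_eq⟩ :=
      isVertexDecomposable_and_dim_chainComplex_of_erase hk del_vd link_vd dim_link
    refine ⟨vd, dim_eq.trans (dim_del.trans (WithBot.coe_inj.2 ?_))⟩
    push_cast
    linarith

theorem isVertexDecomposable_chainComplex_univ (m n : ℕ) :
    IsVertexDecomposable (chainComplex (Finset.univ : Finset (Fin m × Fin n)) m n) := by
  rcases lt_or_ge n m with h | h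
  · exact chainComplex_of_lt Finset.univ h ▸ .simplex _
  cases m with
  | zero => exact chainComplex_zero Finset.univ n ▸ .empty
  | succ m =>
    exact (isVertexDecomposable_and_dim_chainComplex m.lt_succ_self le_rfl (m.le_succ.trans h)
      fun v _ _ => Finset.mem_univ v).1

end Chains

section Vanishing

section Curves

variable {V R : Type*} [CommRing R] [IsDomain R] [Infinite R]

theorem eval_eq_zero_of_forall_ne (f : MvPolynomial V R) (b : V → Polynomial R) (x₀ : R)
    (h : ∀ x ≠ x₀, eval (fun v => (b v).eval x) f = 0) (x : R) :
    eval (fun v => (b v).eval x) f = 0 := by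
  have heval : ∀ x, eval (fun v => (b v).eval x) f = (aeval b f).eval x := fun x => by
    have hid : (Polynomial.evalRingHom x).comp Polynomial.C = RingHom.id R := by ext; simp
    rw [← Polynomial.coe_evalRingHom, aeval_def, hom_eval₂, Polynomial.algebraMap_eq, hid]
    rfl
  have hroot : {x₀}ᶜ ⊆ {x | (aeval b f).IsRoot x} := fun x hx => (heval x).symm.trans (h x hx)
  rw [heval, Polynomial.eq_zero_of_infinite_isRoot _
    ((Set.finite_singleton x₀).infinite_compl.mono hroot), Polynomial.eval_zero]

theorem eval_eq_zero_of_forall_update [DecidableEq V] (f : MvPolynomial V R) (a : V → R) (v : V)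
    (x₀ : R) (h : ∀ x ≠ x₀, eval (Function.update a v x) f = 0) : eval a f = 0 := by
  have hcurve : ∀ x, (fun w => (Function.update (Polynomial.C ∘ a) v Polynomial.X w).eval x) =
      Function.update a v x := fun x => by
    ext w
    by_cases hw : w = v <;> simp [hw]
  rw [← Function.update_eq_self v a, ← hcurve]
  exact eval_eq_zero_of_forall_ne f _ x₀ (fun x hx => by rw [hcurve, h x hx]) (a v)

end Curves

variable {V L : Type*} [Field L]

/-- The conclusion is about the coefficient of `s⁻¹ ^ D` in the value of `f` along the curve. -/
theorem eval_weightedHomogeneousComponent_eq_zero [Infinite L] {f : MvPolynomial V L} {w : V → ℕ}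
    {D : ℕ} (hD : ∀ d ∈ f.support, Finsupp.weight w d ≤ D) (b : V → Polynomial L)
    (h : ∀ s ≠ 0, eval (fun v => s⁻¹ ^ w v * (b v).eval s) f = 0) :
    eval (fun v => (b v).eval 0) (weightedHomogeneousComponent w D f) = 0 := by
  classical
  let g : Polynomial L := ∑ d ∈ f.support, Polynomial.C (coeff d f) *
    Polynomial.X ^ (D - Finsupp.weight w d) * d.prod fun v e => b v ^ e
  have hg : ∀ s, g.eval s = ∑ d ∈ f.support, coeff d f * s ^ (D - Finsupp.weight w d) *
      d.prod fun v e => (b v).eval s ^ e := fun s => by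
    simp [g, Polynomial.eval_finsetSum, Finsupp.prod, Polynomial.eval_prod]
  have hroot : {0}ᶜ ⊆ {s | g.IsRoot s} := fun s (hs : s ≠ 0) => by
    rw [Set.mem_ofPred_eq, Polynomial.IsRoot, hg, ← mul_zero (s ^ D), ← h s hs, eval_eq,
      Finset.mul_sum]
    refine Finset.sum_congr rfl fun d hd => ?_
    have hweight : ∏ v ∈ d.support, (s⁻¹ ^ w v) ^ d v = s⁻¹ ^ Finsupp.weight w d := by
      simp only [← pow_mul', Finset.prod_pow_eq_pow_sum]
      rfl
    simp only [mul_pow, Finset.prod_mul_distrib]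
    rw [hweight, pow_sub₀ s hs (hD d hd), inv_pow, Finsupp.prod]
    ring
  have hg0 : g = 0 := Polynomial.eq_zero_of_infinite_isRoot _
    ((Set.finite_singleton 0).infinite_compl.mono hroot)
  have heval : g.eval 0 = eval (fun v => (b v).eval 0) (weightedHomogeneousComponent w D f) := by
    rw [weightedHomogeneousComponent_apply, map_sum, Finset.sum_filter, hg]
    refine Finset.sum_congr rfl fun d hd => ?_
    split_ifs with hwd
    · simp [hwd, eval_monomial]
    · simp [Nat.sub_ne_zero_of_lt ((hD d hd).lt_of_ne hwd)]
  rw [← heval, hg0, Polynomial.eval_zero]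

variable {M N : ℕ}

/-- `f` vanishes on the matrices whose row `i` is, in the first `n` columns, a linear combination
of the preceding rows. -/
def VanishesOnDependent (i : Fin M) (n : ℕ) (f : MvPolynomial (Fin M × Fin N) L) : Prop :=
  ∀ (a : Fin M × Fin N → L) (l : Fin M → L),
    (∀ j, j.val < n → a (i, j) = ∑ i' ∈ Finset.Iio i, l i' * a (i', j)) → eval a f = 0

theorem VanishesOnDependent.of_degreeOf_eq_zero {i : Fin M} {j : Fin N}
    {f : MvPolynomial (Fin M × Fin N) L} (hf : VanishesOnDependent i (j + 1) f)
    (hdeg : degreeOf (i, j) f = 0) : VanishesOnDependent i j f := by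
  intro a l ha
  let b := Function.update a (i, j) (∑ i' ∈ Finset.Iio i, l i' * a (i', j))
  have hab : eval a f = eval b f := by
    refine eval₂Hom_congr' rfl (fun v hv _ => (Function.update_of_ne ?_ _ _).symm) rfl
    rintro rfl
    exact mem_vars_iff_degreeOf_ne_zero.1 hv hdeg
  refine hab.trans (hf b l fun j' hj' => ?_)
  have hb : ∀ i' ∈ Finset.Iio i, b (i', j') = a (i', j') := fun i' hi' => by
    simp [b, (Finset.mem_Iio.1 hi').ne]
  rw [Finset.sum_congr rfl fun i' hi' => by rw [hb i' hi']]
  rcases (Nat.lt_succ_iff.1 hj').eq_or_lt with h | h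
  · obtain rfl := Fin.ext h
    exact Function.update_self _ _ _
  · rw [← ha j' h]
    exact Function.update_of_ne (ne_of_apply_ne (fun v => v.2.val) h.ne) _ _

section TopPart

variable [DecidableEq V] {f : MvPolynomial V L} {v : V}

/-- The part of `f` of top degree in the variable `v`. -/
def topPart (v : V) (f : MvPolynomial V L) : MvPolynomial V L :=
  weightedHomogeneousComponent (Pi.single v 1) (degreeOf v f) f

theorem mem_support_topPart {d : V →₀ ℕ} :
    d ∈ (topPart v f).support ↔ d ∈ f.support ∧ d v = degreeOf v f := by
  simp [topPart, coeff_weightedHomogeneousComponent, Finsupp.weight_single_one_apply, and_comm]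

theorem topPart_ne_zero (hf : f ≠ 0) : topPart v f ≠ 0 := by
  obtain ⟨d, hd, hdv⟩ := f.support.exists_mem_eq_sup (support_nonempty.2 hf) fun d => d v
  refine support_nonempty.1 ⟨d, mem_support_topPart.2 ⟨hd, ?_⟩⟩
  rw [degreeOf_eq_sup, hdv]

theorem eval_topPart_eq_zero [Infinite L] (b : V → Polynomial L)
    (h : ∀ s ≠ 0, eval (fun u => if u = v then s⁻¹ * (b u).eval s else (b u).eval s) f = 0) :
    eval (fun u => (b u).eval 0) (topPart v f) = 0 := by
  refine eval_weightedHomogeneousComponent_eq_zero (fun d hd => ?_) b fun s hs => ?_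
  · rw [Finsupp.weight_single_one_apply]
    exact monomial_le_degreeOf v hd
  · rw [← h s hs]
    refine congrArg (eval · f) (funext fun u => ?_)
    by_cases hu : u = v <;> simp [hu]

end TopPart

variable [Infinite L] {i : Fin M} {j : Fin N} {f : MvPolynomial (Fin M × Fin N) L}

/-- If the combination `μ` of the rows before `i` vanishes in the columns before `j` but not in
column `j`, then row `i` becomes dependent in the columns up to `j` after a rank one perturbation
of order `s` of the block before `(i, j)` and the rescaling of the entry at `(i, j)` by `s⁻¹`. -/
theorem VanishesOnDependent.eval_topPart_eq_zero (hf : VanishesOnDependent i (j + 1) f)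
    {b : Fin M × Fin N → L} {μ : Fin M → L} (hz : b (i, j) ≠ 0)
    (hcol : ∑ i' ∈ Finset.Iio i, μ i' * b (i', j) ≠ 0)
    (hcols : ∀ j' < j, ∑ i' ∈ Finset.Iio i, μ i' * b (i', j') = 0) :
    eval b (topPart (i, j) f) = 0 := by
  obtain ⟨c, hc⟩ : ∃ c, ∑ i' ∈ Finset.Iio i, μ i' * b (i', j) = c := ⟨_, rfl⟩
  let B : Fin M × Fin N → Polynomial L := fun u => Polynomial.C (b u) +
    Polynomial.C (if u.1 < i ∧ u.2 < j then b (u.1, j) * (b (i, u.2) / b (i, j)) else 0) *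
      Polynomial.X
  have hB0 : (fun u => (B u).eval 0) = b := by simp [B]
  rw [← hB0]
  refine MaxMinors.eval_topPart_eq_zero B fun s hs =>
    hf _ (fun i' => b (i, j) / (s * c) * μ i') fun j' hj' => ?_
  simp only [mul_assoc, ← Finset.mul_sum]
  rcases (Fin.le_def.2 (Nat.lt_succ_iff.1 hj')).eq_or_lt with rfl | hj
  · have hB : ∀ i' ∈ Finset.Iio i, (if (i', j') = (i, j') then s⁻¹ * (B (i', j')).eval s
        else (B (i', j')).eval s) = b (i', j') := fun i' hi' => by
      simp [B, (Finset.mem_Iio.1 hi').ne]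
    rw [Finset.sum_congr rfl fun i' hi' => congrArg (μ i' * ·) (hB i' hi'), hc]
    rw [hc] at hcol
    simp only [B, lt_irrefl, false_and, if_true, if_false, map_zero, zero_mul, add_zero,
      Polynomial.eval_C]
    field_simp
  · have hB : ∀ i' ∈ Finset.Iio i, (if (i', j') = (i, j) then s⁻¹ * (B (i', j')).eval s
        else (B (i', j')).eval s) =
        b (i', j') + b (i', j) * (b (i, j') / b (i, j) * s) := fun i' hi' => by
      have hi := Finset.mem_Iio.1 hi'
      simp [B, hi, hj, hi.ne, mul_assoc]
    rw [Finset.sum_congr rfl fun i' hi' => congrArg (μ i' * ·) (hB i' hi')]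
    simp only [mul_add, ← mul_assoc, Finset.sum_add_distrib, ← Finset.sum_mul, hcols j' hj, hc]
    rw [hc] at hcol
    simp only [B, Prod.mk.injEq, hj.ne, and_false, lt_irrefl, false_and, if_false, map_zero,
      zero_mul, add_zero, Polynomial.eval_C]
    field_simp
    ring

theorem VanishesOnDependent.topPart {p : Fin M} (hp : p.val + 1 = i)
    (hf : VanishesOnDependent i (j + 1) f) : VanishesOnDependent p j (topPart (i, j) f) := by
  intro a l ha
  have hpi : p < i := by lia
  let μ : Fin M → L := Function.update (-l) p 1
  have hμ : ∀ g : Fin M → L,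
      ∑ i' ∈ Finset.Iio i, μ i' * g i' = g p - ∑ i' ∈ Finset.Iio p, l i' * g i' := fun g => by
    have hIio : Finset.Iio i = insert p (Finset.Iio p) := by ext; simp; lia
    rw [hIio, Finset.sum_insert (by simp), sub_eq_add_neg, ← Finset.sum_neg_distrib]
    refine congrArg₂ _ (by simp [μ]) (Finset.sum_congr rfl fun i' hi' => ?_)
    simp [μ, (Finset.mem_Iio.1 hi').ne]
  refine eval_eq_zero_of_forall_update _ a (p, j) (∑ i' ∈ Finset.Iio p, l i' * a (i', j))
    fun x hx => eval_eq_zero_of_forall_update _ _ (i, j) 0 fun z hz =>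
      hf.eval_topPart_eq_zero (μ := μ) (by simpa using hz) ?_ fun j' hj' => ?_
  · have hcol : ∀ i' ∈ Finset.Iio p, l i' *
        Function.update (Function.update a (p, j) x) (i, j) z (i', j) = l i' * a (i', j) :=
      fun i' hi' => by
        simp [(Finset.mem_Iio.1 hi').ne, ((Finset.mem_Iio.1 hi').trans hpi).ne]
    rw [hμ, Finset.sum_congr rfl hcol, sub_ne_zero]
    simpa [hpi.ne] using hx
  · rw [hμ, sub_eq_zero]
    simpa [hj'.ne] using ha j' hj'

/-- Peeling off the last column and passing to top parts along it strips the diagonal terms. -/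
theorem VanishesOnDependent.eq_zero {n : ℕ} (hn : n ≤ N) (hf : VanishesOnDependent i n f)
    (hchain : ∀ d ∈ f.support, ¬ HasChain d.support (i + 1) n) : f = 0 := by
  induction n generalizing i f with
  | zero => exact MvPolynomial.funext fun a => by simpa using hf a 0 (by simp)
  | succ n ih =>
    obtain ⟨j, rfl⟩ : ∃ j : Fin N, j.val = n := ⟨⟨n, hn⟩, rfl⟩
    simp only [hasChain_succ_iff, not_or, not_and, Finsupp.mem_support_iff] at hchain
    by_cases hdeg : degreeOf (i, j) f = 0
    · exact ih j.2.le (hf.of_degreeOf_eq_zero hdeg) fun d hd => (hchain d hd).1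
    by_contra hf0
    have hchain_top : ∀ d ∈ (MaxMinors.topPart (i, j) f).support, ¬ HasChain d.support i j :=
      fun d hd => by
        obtain ⟨hd, hdv⟩ := mem_support_topPart.1 hd
        exact (hchain d hd).2 (hdv.trans_ne hdeg)
    have hne := topPart_ne_zero (v := (i, j)) hf0
    rcases Nat.eq_zero_or_pos i.val with hi | hi
    · obtain ⟨d, hd⟩ := support_nonempty.2 hne
      exact hchain_top d hd (hi ▸ hasChain_zero _ _)
    · obtain ⟨p, hp⟩ : ∃ p : Fin M, p.val + 1 = i := ⟨⟨i - 1, by lia⟩, by simp; lia⟩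
      exact hne (ih j.2.le (hf.topPart hp) (hp ▸ hchain_top))

end Vanishing

/-- Divide by the `b i`; the remainder vanishes. -/
theorem exists_degree_le_degree {V R ι : Type*} [CommRing R] [IsDomain R] {σ : MonomialOrder V}
    {I : Ideal (MvPolynomial V R)} {b : ι → MvPolynomial V R} (hbI : ∀ i, b i ∈ I)
    (hb : ∀ i, IsUnit (σ.leadingCoeff (b i)))
    (hI : ∀ r ∈ I, (∀ d ∈ r.support, ∀ i, ¬ σ.degree (b i) ≤ d) → r = 0)
    {f : MvPolynomial V R} (hf : f ∈ I) (hf0 : f ≠ 0) : ∃ i, σ.degree (b i) ≤ σ.degree f := by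
  obtain ⟨g, r, hfr, hdeg, hr⟩ := σ.div hb f
  have hr0 : r = 0 := hI r (eq_sub_of_add_eq' hfr.symm ▸ sub_mem hf (by
    rw [Finsupp.linearCombination_apply]
    exact sum_mem fun i _ => Ideal.mul_mem_left _ _ (hbI i))) hr
  rw [hr0, add_zero, Finsupp.linearCombination_apply] at hfr
  obtain ⟨i, -, hi⟩ : ∃ i ∈ g.support, coeff (σ.degree f) (g i • b i) ≠ 0 := by
    refine Finset.exists_ne_zero_of_sum_ne_zero ?_
    rw [← coeff_sum]
    exact (congrArg (coeff (σ.degree f)) hfr).symm.trans_ne (σ.coeff_degree_ne_zero_iff.2 hf0)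
  rw [smul_eq_mul, mul_comm] at hi
  have hne : b i * g i ≠ 0 := fun h => hi (by rw [h, coeff_zero])
  have hdeg_eq : σ.degree (b i * g i) = σ.degree f :=
    σ.toSyn.injective (le_antisymm (hdeg i) (σ.le_degree (mem_support_iff.2 hi)))
  refine ⟨i, ?_⟩
  rw [← hdeg_eq, σ.degree_mul (left_ne_zero_of_mul hne) (right_ne_zero_of_mul hne)]
  exact le_self_add

section MaximalMinors

variable {m n : ℕ}

/-- The exponent of the diagonal term on the columns `c`. -/
def diagExponent (c : Fin m ↪o Fin n) : Fin m × Fin n →₀ ℕ :=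
  ∑ i, Finsupp.single (i, c i) 1

theorem diagExponent_le_iff {c : Fin m ↪o Fin n} {d : Fin m × Fin n →₀ ℕ} :
    diagExponent c ≤ d ↔ ∀ i, (i, c i) ∈ d.support := by
  classical
  have hsum : diagExponent c = ∑ v ∈ Finset.univ.image fun i => (i, c i), Finsupp.single v 1 := by
    rw [Finset.sum_image fun i _ j _ h => congrArg Prod.fst h, diagExponent]
  rw [hsum, sum_single_one_le_iff]
  simp [Finset.image_subset_iff]

theorem exists_diagExponent_le_iff {d : Fin m × Fin n →₀ ℕ} :
    (∃ c : Fin m ↪o Fin n, diagExponent c ≤ d) ↔ HasChain d.support m n := by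
  simp only [hasChain_iff_exists_orderEmbedding, diagExponent_le_iff]

variable (K : Type*) [Field K]

/-- The maximal minor on the columns `c`. -/
def maxMinor (c : Fin m ↪o Fin n) : MvPolynomial (Fin m × Fin n) K :=
  minor K (RelEmbedding.refl _) c

theorem minors_eq_range : minors m n K m = Set.range (maxMinor K) := by
  refine Set.Subset.antisymm ?_ (Set.range_subset_iff.2 fun c => ⟨_, c, rfl⟩)
  rintro _ ⟨r, c, rfl⟩
  have hrange : Set.range r = Set.range id := by
    rw [(Finite.injective_iff_surjective.1 r.injective).range_eq, Set.range_id]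
  obtain rfl : r = RelEmbedding.refl _ :=
    DFunLike.coe_injective ((StrictMono.range_inj r.strictMono strictMono_id).1 hrange)
  exact ⟨c, rfl⟩

variable {K}

theorem maxMinor_mem_minorsIdeal (c : Fin m ↪o Fin n) : maxMinor K c ∈ minorsIdeal m n K m :=
  Ideal.subset_span (minors_eq_range K ▸ Set.mem_range_self c)

theorem exists_perm_of_mem_support_maxMinor {c : Fin m ↪o Fin n} {d : Fin m × Fin n →₀ ℕ}
    (hd : d ∈ (maxMinor K c).support) :
    ∃ π : Equiv.Perm (Fin m), d = ∑ i, Finsupp.single (π i, c i) 1 := by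
  classical
  rw [mem_support_iff, maxMinor, minor, Matrix.det_apply, coeff_sum] at hd
  obtain ⟨π, -, hπ⟩ := Finset.exists_ne_zero_of_sum_ne_zero hd
  have hterm : ∏ i, ((Matrix.mvPolynomialX (Fin m) (Fin n) K).submatrix
      (RelEmbedding.refl (· ≤ ·)) c) (π i) i
        = monomial (∑ i, Finsupp.single (π i, c i) 1) (1 : K) :=
    (monomial_sum_one _ _).symm
  refine ⟨π, ?_⟩
  contrapose! hπ
  rw [hterm, coeff_smul, coeff_monomial, if_neg hπ.symm, smul_zero]

theorem eq_of_diagExponent_le_of_mem_support_maxMinor {c c' : Fin m ↪o Fin n}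
    {d : Fin m × Fin n →₀ ℕ} (hd : d ∈ (maxMinor K c).support) (hle : diagExponent c' ≤ d) :
    c' = c := by
  obtain ⟨π, rfl⟩ := exists_perm_of_mem_support_maxMinor hd
  have hcomp : (c' : Fin m → Fin n) = c ∘ π.symm := funext fun i => by
    have hi := diagExponent_le_iff.1 hle i
    rw [Finsupp.mem_support_iff, Finsupp.finsetSum_apply] at hi
    obtain ⟨k, -, hk⟩ := Finset.exists_ne_zero_of_sum_ne_zero hi
    rw [Finsupp.single_apply, ite_ne_right_iff, Prod.mk.injEq] at hk
    rw [← hk.1.2, ← hk.1.1, Function.comp_apply, Equiv.symm_apply_apply]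
  refine DFunLike.coe_injective ((StrictMono.range_inj c'.strictMono c.strictMono).1 ?_)
  rw [hcomp, EquivLike.range_comp]

theorem vanishesOnDependent_of_mem_minorsIdeal {L : Type*} [Field L] [Algebra K L]
    {f : MvPolynomial (Fin m × Fin n) K} (hf : f ∈ minorsIdeal m n K m) (i : Fin m) :
    VanishesOnDependent i n (map (algebraMap K L) f) := by
  intro a l ha
  suffices h : minorsIdeal m n K m ≤ RingHom.ker (eval₂Hom (algebraMap K L) a) by
    rw [eval_map]
    exact h hf
  rw [minorsIdeal, minors_eq_range, Ideal.span_le]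
  rintro _ ⟨c, rfl⟩
  rw [SetLike.mem_coe, RingHom.mem_ker, maxMinor, minor, RingHom.map_det]
  have hmap : (eval₂Hom (algebraMap K L) a).mapMatrix
      ((Matrix.mvPolynomialX (Fin m) (Fin n) K).submatrix (RelEmbedding.refl (· ≤ ·)) c) =
      Matrix.of fun i' j => a (i', c j) := by ext i' j; simp
  have hrow : Matrix.of (fun i' j => a (i', c j)) i =
      ∑ i' ∈ Finset.Iio i, l i' • fun j => a (i', c j) := by
    ext j
    simpa using ha (c j) (c j).2
  rw [hmap]
  refine Matrix.det_eq_zero_of_not_linearIndependent_rows fun hli =>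
    hli.notMem_span_image (s := Set.Iio i) (lt_irrefl i) ?_
  rw [hrow]
  exact sum_mem fun i' hi' => Submodule.smul_mem _ _
    (Submodule.subset_span ⟨i', Finset.mem_Iio.1 hi', rfl⟩)

/-- The monomials not divisible by a diagonal term are linearly independent modulo the ideal of
maximal minors. The field is enlarged to have enough points. -/
theorem eq_zero_of_mem_minorsIdeal {f : MvPolynomial (Fin m × Fin n) K}
    (hf : f ∈ minorsIdeal m n K m) (hchain : ∀ d ∈ f.support, ¬ HasChain d.support m n) :
    f = 0 := by
  cases m with
  | zero => exact support_eq_empty.1 (Finset.eq_empty_of_forall_notMem fun d hd =>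
      hchain d hd (hasChain_zero _ _))
  | succ m =>
    let L := AlgebraicClosure K
    have infinite : Infinite L := IsAlgClosed.instInfinite
    have hinj := (algebraMap K L).injective
    have hvanish := vanishesOnDependent_of_mem_minorsIdeal (L := L) hf (Fin.last m)
    refine map_injective _ hinj ((hvanish.eq_zero le_rfl fun d hd => hchain d ?_).trans
      (map_zero _).symm)
    rwa [support_map_of_injective _ hinj] at hd

variable {σ : MonomialOrder (Fin m × Fin n)}
  (hσ : ∀ c : Fin m ↪o Fin n, σ.leadingTerm (maxMinor K c) = ∏ i, X (i, c i))
include hσ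

theorem leadingTerm_maxMinor (c : Fin m ↪o Fin n) :
    σ.leadingTerm (maxMinor K c) = monomial (diagExponent c) 1 :=
  (hσ c).trans (monomial_sum_one _ _).symm

theorem degree_maxMinor (c : Fin m ↪o Fin n) : σ.degree (maxMinor K c) = diagExponent c := by
  classical
  rw [← σ.degree_leadingTerm, leadingTerm_maxMinor hσ, σ.degree_monomial, if_neg one_ne_zero]

theorem monic_maxMinor (c : Fin m ↪o Fin n) : σ.Monic (maxMinor K c) := by
  have h := leadingTerm_maxMinor hσ c
  rw [MonomialOrder.leadingTerm, monomial_eq_monomial_iff] at h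
  simpa [MonomialOrder.Monic, degree_maxMinor hσ] using h

theorem hasChain_degree_of_mem_minorsIdeal {f : MvPolynomial (Fin m × Fin n) K}
    (hf : f ∈ minorsIdeal m n K m) (hf0 : f ≠ 0) : HasChain (σ.degree f).support m n := by
  rw [← exists_diagExponent_le_iff]
  simp only [← degree_maxMinor hσ]
  refine exists_degree_le_degree maxMinor_mem_minorsIdeal
    (fun c => (monic_maxMinor hσ c).symm ▸ isUnit_one) (fun r hr hdeg => ?_) hf hf0
  refine eq_zero_of_mem_minorsIdeal hr fun d hd hchain => ?_
  obtain ⟨c, hc⟩ := exists_diagExponent_le_iff.2 hchain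
  exact hdeg d hd c (degree_maxMinor hσ c ▸ hc)

theorem image_leadingTerm_maxMinor (S : Set (Fin m ↪o Fin n)) :
    σ.leadingTerm '' (maxMinor K '' S) = (fun d => monomial d (1 : K)) '' (diagExponent '' S) := by
  simp only [Set.image_image, leadingTerm_maxMinor hσ]

theorem span_leadingTerm_minors : Ideal.span (σ.leadingTerm '' minors m n K m) =
    stanleyReisnerIdeal K (chainComplex Finset.univ m n) := by
  ext f
  rw [minors_eq_range, ← Set.image_univ, image_leadingTerm_maxMinor hσ,
    mem_ideal_span_monomial_image, mem_stanleyReisnerIdeal]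
  simp [mem_chainComplex, ← exists_diagExponent_le_iff]

theorem initialIdeal_minorsIdeal : initialIdeal σ (minorsIdeal m n K m) =
    stanleyReisnerIdeal K (chainComplex Finset.univ m n) := by
  refine le_antisymm (Ideal.span_le.2 ?_) ?_
  · rintro _ ⟨f, hf, rfl⟩
    rw [SetLike.mem_coe, mem_stanleyReisnerIdeal]
    intro d hd
    rcases eq_or_ne f 0 with rfl | hf0
    · simp at hd
    · rw [σ.support_leadingTerm' hf0, Finset.mem_singleton] at hd
      rw [hd, mem_chainComplex]
      exact fun h => h.2 (hasChain_degree_of_mem_minorsIdeal hσ hf hf0)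
  · rw [← span_leadingTerm_minors hσ]
    exact Ideal.span_mono (Set.image_mono Ideal.subset_span)

theorem isReducedGroebnerBasis_minors :
    IsReducedGroebnerBasis σ (minors m n K m) (minorsIdeal m n K m) := by
  refine ⟨⟨?_, Ideal.subset_span, ?_⟩, ?_⟩
  · exact minors_eq_range K ▸ Set.finite_range _
  · rw [span_leadingTerm_minors hσ, initialIdeal_minorsIdeal hσ]
  rw [minors_eq_range]
  rintro _ ⟨c, rfl⟩
  refine ⟨monic_maxMinor hσ c, fun d hd hmem => ?_⟩
  have hsub : Set.range (maxMinor K) \ {maxMinor K c} ⊆ maxMinor K '' {c' | c' ≠ c} := by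
    rintro _ ⟨⟨c', rfl⟩, hne⟩
    exact ⟨c', ne_of_apply_ne _ hne, rfl⟩
  replace hmem := Ideal.span_mono (Set.image_mono hsub) hmem
  rw [image_leadingTerm_maxMinor hσ, mem_ideal_span_monomial_image] at hmem
  obtain ⟨_, ⟨c', hc', rfl⟩, hle⟩ := hmem d (by classical simp [support_monomial])
  exact hc' (eq_of_diagExponent_le_of_mem_support_maxMinor hd hle)

end MaximalMinors

end MaxMinors

end

theorem theorem2p1_general {K : Type*} [Field K] (m n : ℕ) (σ : MonomialOrder (Fin m × Fin n))
    (hσ : ∀ c : Fin m ↪o Fin n,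
      σ.leadingTerm (MaxMinors.maxMinor K c) = ∏ i, MvPolynomial.X (i, c i)) :
    MaxMinors.IsReducedGroebnerBasis σ (MaxMinors.minors m n K m)
        (MaxMinors.minorsIdeal m n K m) ∧
    MaxMinors.IsSquarefreeMonomialIdeal
        (MaxMinors.initialIdeal σ (MaxMinors.minorsIdeal m n K m)) ∧
    MaxMinors.IsCohenMacaulayIdeal
        (MaxMinors.initialIdeal σ (MaxMinors.minorsIdeal m n K m)) ∧
    (∃! Δ : LowerSet (Finset (Fin m × Fin n)),
      MaxMinors.stanleyReisnerIdeal K Δ =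
        MaxMinors.initialIdeal σ (MaxMinors.minorsIdeal m n K m)) ∧
    ∀ Δ : LowerSet (Finset (Fin m × Fin n)),
      MaxMinors.stanleyReisnerIdeal K Δ =
          MaxMinors.initialIdeal σ (MaxMinors.minorsIdeal m n K m) →
        MaxMinors.IsVertexDecomposable Δ := by
  refine ⟨MaxMinors.isReducedGroebnerBasis_minors hσ, ?_⟩
  rw [MaxMinors.initialIdeal_minorsIdeal hσ]
  have decomposable := MaxMinors.isVertexDecomposable_chainComplex_univ m n
  refine ⟨⟨_, MaxMinors.stanleyReisnerIdeal_eq_span_image _⟩, decomposable.isCohenMacaulayIdeal,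
    ⟨_, rfl, fun Δ h => MaxMinors.stanleyReisnerIdeal_injective h⟩, fun Δ h => ?_⟩
  exact MaxMinors.stanleyReisnerIdeal_injective h ▸ decomposable

theorem theorem2p1 {K : Type*} [Field K] (m n : ℕ) (hm : 1 ≤ m) (hmn : m ≤ n)
    (σ : MonomialOrder (Fin m × Fin n)) (hσ : MaxMinors.IsDiagonal K σ) :
    MaxMinors.IsReducedGroebnerBasis σ (MaxMinors.minors m n K m)
        (MaxMinors.minorsIdeal m n K m) ∧
    MaxMinors.IsSquarefreeMonomialIdeal
        (MaxMinors.initialIdeal σ (MaxMinors.minorsIdeal m n K m)) ∧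
    MaxMinors.IsCohenMacaulayIdeal
        (MaxMinors.initialIdeal σ (MaxMinors.minorsIdeal m n K m)) ∧
    (∃! Δ : LowerSet (Finset (Fin m × Fin n)),
      MaxMinors.stanleyReisnerIdeal K Δ =
        MaxMinors.initialIdeal σ (MaxMinors.minorsIdeal m n K m)) ∧
    ∀ Δ : LowerSet (Finset (Fin m × Fin n)),
      MaxMinors.stanleyReisnerIdeal K Δ =
          MaxMinors.initialIdeal σ (MaxMinors.minorsIdeal m n K m) →
        MaxMinors.IsVertexDecomposable Δ :=
  theorem2p1_general m n σ (hσ m (RelEmbedding.refl _))
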